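/- Let $G'=\mathrm{SL}(2,\mathbb R)\ltimes\mathbb R^2$ with multiplication $(M,\xi)(M',\xi')=(MM',\xi M'+\xi')$, where elements of $\mathbb R^2$ are row vectors, and let $\Gamma'=\mathrm{SL}(2,\mathbb Z)\ltimes\mathbb Z^2$ be its subgroup of integer points. Let $X=\Gamma'\backslash G'$ be the space of affine lattices, and let $\mu$ be the Haar probability measure on $X$, that is, the Borel probability measure on $X$ that is invariant under right multiplication by $G'$ (the existence of such a measure is part of the claim, and the formula below holds for every such measure). Let $F\in L^1(\mathbb R^4)$, real- or complex-valued, where $\mathbb R^4=\mathbb R^2\times\mathbb R^2$. Then for $\mu$-almost every $\Gamma'(M,\xi)\in X$ the series $$\sum_{\substack{m_1,m_2\in\mathbb Z^2\\ m_1\ne m_2}}F(m_1M+\xi,\;m_2M+\xi)$$ converges absolutely. Its sum depends only on the coset $\Gamma'(M,\xi)$ and defines a $\mu$-integrable function on $X$, and $$\int_X\ \sum_{\substack{m_1,m_2\in\mathbb Z^2\\ m_1\ne m_2}}F(m_1M+\xi,\,m_2M+\xi)\,d\mu(M,\xi)=\int_{\mathbb R^4}F(x)\,dx .$$ -/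

import Mathlib

open MeasureTheory

/-- The group `SL(2,ℝ) ⋉ ℝ²` of pairs `(M, ξ)`, where `ξ` is a row vector. -/
@[ext]
structure ASL2 where
  lin : Matrix.SpecialLinearGroup (Fin 2) ℝ
  shift : Fin 2 → ℝ

namespace ASL2

/-- The group law `(M, ξ) (M', ξ') = (M M', ξ M' + ξ')`. -/
instance : Mul ASL2 where
  mul g h := ⟨g.lin * h.lin, Matrix.vecMul g.shift h.lin.1 + h.shift⟩

instance : One ASL2 where
  one := ⟨1, 0⟩

instance : Inv ASL2 where
  inv g := ⟨g.lin⁻¹, -Matrix.vecMul g.shift (g.lin⁻¹).1⟩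

@[simp] theorem mul_lin (g h : ASL2) : (g * h).lin = g.lin * h.lin := rfl

@[simp] theorem mul_shift (g h : ASL2) :
    (g * h).shift = Matrix.vecMul g.shift h.lin.1 + h.shift := rfl

@[simp] theorem one_lin : (1 : ASL2).lin = 1 := rfl

@[simp] theorem one_shift : (1 : ASL2).shift = 0 := rfl

@[simp] theorem inv_lin (g : ASL2) : g⁻¹.lin = g.lin⁻¹ := rfl

@[simp] theorem inv_shift (g : ASL2) :
    g⁻¹.shift = -Matrix.vecMul g.shift (g.lin⁻¹).1 := rfl

instance : Group ASL2 :=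
  Group.ofLeftAxioms
    (fun a b c => by
      ext1
      · exact mul_assoc _ _ _
      · simp [Matrix.add_vecMul, Matrix.vecMul_vecMul, add_assoc])
    (fun a => by
      ext1
      · exact one_mul _
      · simp)
    (fun a => by
      ext1
      · exact inv_mul_cancel _
      · simp only [mul_shift, inv_shift, Matrix.neg_vecMul, Matrix.vecMul_vecMul, one_shift]
        rw [← Matrix.SpecialLinearGroup.coe_mul, inv_mul_cancel, Matrix.SpecialLinearGroup.coe_one,
          Matrix.vecMul_one, neg_add_cancel])

/-- The topology of `SL(2,ℝ) × ℝ²`. -/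
instance : TopologicalSpace ASL2 :=
  TopologicalSpace.induced (fun g => (g.lin, g.shift)) inferInstance

/-- The right action of `SL(2,ℝ) ⋉ ℝ²` on `ℝ²`: `x (M, ξ) = x M + ξ`. -/
def act (x : Fin 2 → ℝ) (g : ASL2) : Fin 2 → ℝ := Matrix.vecMul x g.lin.1 + g.shift

theorem act_mul (x : Fin 2 → ℝ) (g h : ASL2) : act x (g * h) = act (act x g) h := by
  simp [act, Matrix.add_vecMul, Matrix.vecMul_vecMul, add_assoc]

/-- The inclusion of `ℤ²` into `ℝ²`. -/
def intVec (m : Fin 2 → ℤ) : Fin 2 → ℝ := fun i => (m i : ℝ)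

/-- The element of `SL(2,ℝ) ⋉ ℝ²` given by integer data `γ ∈ SL(2,ℤ)`, `m ∈ ℤ²`. -/
def ofInt (γ : Matrix.SpecialLinearGroup (Fin 2) ℤ) (m : Fin 2 → ℤ) : ASL2 :=
  ⟨γ.map (Int.castRingHom ℝ), intVec m⟩

theorem vecMul_intVec (m : Fin 2 → ℤ) (γ : Matrix.SpecialLinearGroup (Fin 2) ℤ) :
    Matrix.vecMul (intVec m) (γ.map (Int.castRingHom ℝ)).1 = intVec (Matrix.vecMul m γ.1) := by
  ext i
  simp [intVec, Matrix.vecMul, dotProduct]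

/-- The subgroup `SL(2,ℤ) ⋉ ℤ²` of integer points. -/
def integerPoints : Subgroup ASL2 where
  carrier := {g | ∃ γ m, g = ofInt γ m}
  mul_mem' := by
    rintro _ _ ⟨γ, m, rfl⟩ ⟨γ', m', rfl⟩
    refine ⟨γ * γ', Matrix.vecMul m γ'.1 + m', ?_⟩
    ext1
    · simp [ofInt]
    · simp only [mul_shift, ofInt, vecMul_intVec]
      ext i
      simp [intVec]
  one_mem' := by
    refine ⟨1, 0, ?_⟩
    ext1
    · simp [ofInt]
    · ext i
      simp [ofInt, intVec]
  inv_mem' := by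
    rintro _ ⟨γ, m, rfl⟩
    refine ⟨γ⁻¹, -Matrix.vecMul m (γ⁻¹).1, ?_⟩
    ext1
    · simp [ofInt]
    · simp only [inv_shift, ofInt, ← map_inv, vecMul_intVec]
      ext i
      simp [intVec]

theorem act_intVec_ofInt (n : Fin 2 → ℤ) (γ : Matrix.SpecialLinearGroup (Fin 2) ℤ)
    (m : Fin 2 → ℤ) :
    act (intVec n) (ofInt γ m) = intVec (Matrix.vecMul n γ.1 + m) := by
  simp only [act, ofInt, vecMul_intVec]
  ext i
  simp [intVec]

theorem act_intVec_ofInt_bijective (γ : Matrix.SpecialLinearGroup (Fin 2) ℤ)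
    (m : Fin 2 → ℤ) :
    Function.Bijective (fun n : Fin 2 → ℤ => Matrix.vecMul n γ.1 + m) := by
  refine Function.bijective_iff_has_inverse.2 ⟨fun n => Matrix.vecMul (n - m) (γ⁻¹).1, ?_, ?_⟩
  · intro n
    simp only [add_sub_cancel_right, Matrix.vecMul_vecMul]
    rw [← Matrix.SpecialLinearGroup.coe_mul, mul_inv_cancel, Matrix.SpecialLinearGroup.coe_one,
      Matrix.vecMul_one]
  · intro n
    simp only [Matrix.vecMul_vecMul]
    rw [← Matrix.SpecialLinearGroup.coe_mul, inv_mul_cancel, Matrix.SpecialLinearGroup.coe_one,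
      Matrix.vecMul_one, sub_add_cancel]

/-- The pairs `(m₁, m₂)` of distinct elements of `ℤ²`. -/
abbrev DistinctPairs : Type := {p : (Fin 2 → ℤ) × (Fin 2 → ℤ) // p.1 ≠ p.2}

/-- The term `F (m₁ M + ξ, m₂ M + ξ)` for `g = (M, ξ)` and `p = (m₁, m₂)`. -/
def pairTerm {α : Type*} (F : (Fin 2 → ℝ) × (Fin 2 → ℝ) → α) (g : ASL2)
    (p : DistinctPairs) : α :=
  F (act (intVec p.1.1) g, act (intVec p.1.2) g)

/-- Left multiplication of `g` by an integer point only permutes the terms. -/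
theorem exists_pairTerm_mul {α : Type*} (F : (Fin 2 → ℝ) × (Fin 2 → ℝ) → α)
    (g h : ASL2) (hh : h ∈ integerPoints) :
    ∃ e : DistinctPairs ≃ DistinctPairs, ∀ p, pairTerm F (h * g) p = pairTerm F g (e p) := by
  obtain ⟨γ, m, rfl⟩ := hh
  let e₀ := Equiv.ofBijective _ (act_intVec_ofInt_bijective γ m)
  refine ⟨(e₀.prodCongr e₀).subtypeEquiv fun p => ?_, fun p => ?_⟩
  · simp
  · simp only [pairTerm, act_mul, act_intVec_ofInt]
    rfl

end ASL2

/-- The space of affine lattices `X = Γ' \ G'`, where `G' = SL(2,ℝ) ⋉ ℝ²` and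
`Γ' = SL(2,ℤ) ⋉ ℤ²` acts on `G'` by left multiplication. -/
def AffineLatticeSpace : Type :=
  MulAction.orbitRel.Quotient ASL2.integerPoints ASL2

namespace AffineLatticeSpace

/-- The projection `g ↦ Γ' g`. -/
def mk (g : ASL2) : AffineLatticeSpace :=
  Quotient.mk (MulAction.orbitRel ASL2.integerPoints ASL2) g

/-- The quotient topology. -/
instance : TopologicalSpace AffineLatticeSpace :=
  TopologicalSpace.coinduced mk inferInstance

/-- The Borel σ-algebra of the quotient topology. -/
instance : MeasurableSpace AffineLatticeSpace := borel AffineLatticeSpace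

instance : BorelSpace AffineLatticeSpace := ⟨rfl⟩

/-- The right action of `G'` on `X`: `Γ' h ↦ Γ' h g`. -/
def translate (g : ASL2) : AffineLatticeSpace → AffineLatticeSpace :=
  Quotient.lift (fun h => mk (h * g)) (by
    rintro a b ⟨γ, rfl⟩
    exact Quotient.sound ⟨γ, (mul_assoc (γ : ASL2) b g).symm⟩)

theorem continuous_translate (g : ASL2) : Continuous (translate g) := by
  have h0 : Continuous (fun h : ASL2 => (h.lin, h.shift)) := continuous_induced_dom
  have h1 : Continuous (fun h : ASL2 => h * g) := by
    refine continuous_induced_rng.2 ?_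
    exact (h0.fst.mul continuous_const).prodMk
      ((h0.snd.matrix_vecMul continuous_const).add continuous_const)
  have h2 : Topology.IsQuotientMap mk := ⟨⟨rfl⟩, Quotient.mk_surjective⟩
  exact h2.continuous_iff.2 (h2.continuous.comp h1)

/-- `μ` is the Haar probability measure of `X = Γ' \ G'`: a Borel probability measure that is
invariant under the right action of `G'`. -/
structure IsHaarProbability (μ : Measure AffineLatticeSpace) : Prop where
  isProbabilityMeasure : IsProbabilityMeasure μ
  map_translate : ∀ g : ASL2, μ.map (translate g) = μ

/-- The function `Γ' (M, ξ) ↦ ∑_{m₁ ≠ m₂ ∈ ℤ²} F (m₁ M + ξ, m₂ M + ξ)` on `X`. -/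
noncomputable def pairSum {𝕜 : Type*} [RCLike 𝕜] (F : (Fin 2 → ℝ) × (Fin 2 → ℝ) → 𝕜) :
    AffineLatticeSpace → 𝕜 :=
  Quotient.lift (fun g => ∑' p, ASL2.pairTerm F g p) (by
    rintro a b ⟨γ, rfl⟩
    obtain ⟨e, he⟩ := ASL2.exists_pairTerm_mul F b γ γ.2
    exact (tsum_congr he).trans (e.tsum_eq (ASL2.pairTerm F b)))

end AffineLatticeSpace

/-!
The mean value formula holds for every invariant probability measure `μ`, by invariance alone; that
there is one means that `Γ'` has finite covolume.

**Existence.** A Haar measure on `G'` is obtained from Lebesgue measure by normalizing the matrices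
of determinant between `0` and `1` to determinant one (`ASL2.haar`). A Siegel set for `SL(2, ℤ)` has
finite volume (`ASL2.volume_cone_siegelSet_ne_top`), so there is an integrable function on `G'`
whose sum over every `Γ'`-orbit is one (`ASL2.orbitWeight`, `ASL2.tsum_orbitWeight`). The image in
`X` of the Haar measure with this density is finite and invariant
(`AffineLatticeSpace.exists_isHaarProbability`).

**From pairs to vectors.** Invariance of `μ` under the translations `(1, t)` allows one to replace
the sum of a function over the points of the affine lattice `ℤ² M + ξ` by its integral over the
plane, even if the function depends on the lattice `ℤ² M`
(`IsHaarProbability.lintegral_tsum_act`). Writing `m₂ = m₁ + k` with `k ≠ 0`, this reduces the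
formula for pairs to Siegel's mean value formula: the expectation of `∑_{k ≠ 0} f (k M)` is `∫ f`
(`IsHaarProbability.lintegral_tsum_lattice`).

**Siegel's formula.** The expected number of primitive vectors of `ℤ² M` in a set defines an
`SL(2, ℝ)`-invariant measure on the plane. It is locally finite, because two independent vectors of
a lattice of covolume one are not both short, and so it is a multiple of Lebesgue measure
(`eq_smul_volume_of_map_vecMul_eq`). Summing over the multiples of primitive vectors shows that the
formula holds up to a constant factor. The number of lattice points in a square of side `n`, divided
by `n²`, tends to one, and it is at most the number of lattice points in the unit ball, which is
integrable by the formula with a constant; by dominated convergence the constant is one.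

All this is proved for nonnegative functions. It gives absolute convergence almost everywhere for
integrable functions, and their formula by splitting into positive and negative parts of real and
imaginary parts (`IsHaarProbability.integral_pairSum`).
-/

/-! ### The Borel structure of the group and of the space of affine lattices -/

section BorelStructure

open Topology

local notation "ℝ²" => (Fin 2 → ℝ)

namespace ASL2

instance : MeasurableSpace ASL2 := borel ASL2

instance : BorelSpace ASL2 := ⟨rfl⟩

/-- The entries of `(M, ξ)`, as a point of `ℝ⁴ × ℝ²`. -/
def toProd (g : ASL2) : (Fin 2 → Fin 2 → ℝ) × ℝ² := (g.lin.1, g.shift)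

theorem isClosedEmbedding_toProd : IsClosedEmbedding toProd := by
  have h1 : IsInducing (fun g : ASL2 => (g.lin, g.shift)) := ⟨rfl⟩
  have h2 : IsInducing (Prod.map (Subtype.val : Matrix.SpecialLinearGroup (Fin 2) ℝ → _)
      (id : ℝ² → ℝ²)) := IsInducing.subtypeVal.prodMap IsInducing.id
  have h3 : IsInducing toProd := h2.comp h1
  refine ⟨⟨h3, ?_⟩, ?_⟩
  · rintro ⟨M, ξ⟩ ⟨M', ξ'⟩ h
    have h1 := congrArg Prod.fst h
    have h2 := congrArg Prod.snd h
    exact ASL2.ext (Subtype.ext h1) h2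
  · have : Set.range toProd = {p | p.1 0 0 * p.1 1 1 - p.1 0 1 * p.1 1 0 = 1} := by
      ext p
      constructor
      · rintro ⟨g, rfl⟩
        have := g.lin.2
        rwa [Matrix.det_fin_two] at this
      · intro h
        exact ⟨⟨⟨p.1, (Matrix.det_fin_two (Matrix.of p.1)).trans h⟩, p.2⟩, rfl⟩
    rw [this]
    exact isClosed_eq (by fun_prop) continuous_const

instance : PolishSpace ASL2 := isClosedEmbedding_toProd.polishSpace

theorem measurable_iff_toProd {α : Type*} [MeasurableSpace α] {f : α → ASL2} :
    Measurable f ↔ Measurable fun a => toProd (f a) :=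
  (isClosedEmbedding_toProd.measurableEmbedding.measurable_comp_iff).symm

theorem measurable_toProd : Measurable toProd := measurable_iff_toProd.1 measurable_id

theorem measurable_mk {α : Type*} [MeasurableSpace α]
    {f : α → Matrix.SpecialLinearGroup (Fin 2) ℝ} {s : α → ℝ²}
    (hf : ∀ i j, Measurable fun a => (f a).1 i j) (hs : Measurable s) :
    Measurable fun a => (⟨f a, s a⟩ : ASL2) :=
  measurable_iff_toProd.2
    ((measurable_pi_lambda _ fun i => measurable_pi_lambda _ (hf i)).prodMk hs)

@[fun_prop]
theorem measurable_lin_apply (i j : Fin 2) : Measurable fun g : ASL2 => g.lin.1 i j :=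
  (measurable_pi_apply j).comp
    ((measurable_pi_apply i).comp (measurable_fst.comp measurable_toProd))

@[fun_prop]
theorem measurable_shift : Measurable ASL2.shift := measurable_snd.comp measurable_toProd

theorem measurable_vecMul_lin : Measurable fun p : ASL2 × ℝ² => Matrix.vecMul p.2 p.1.lin.1 := by
  refine measurable_pi_lambda _ fun i => ?_
  simp only [Matrix.vecMul, dotProduct, Fin.sum_univ_two]
  have h (j : Fin 2) : Measurable fun p : ASL2 × ℝ² => p.1.lin.1 j i :=
    (measurable_lin_apply j i).comp measurable_fst
  exact (((measurable_pi_apply 0).comp measurable_snd).mul (h 0)).add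
    (((measurable_pi_apply 1).comp measurable_snd).mul (h 1))

theorem measurable_vecMul_lin_left (v : ℝ²) :
    Measurable fun g : ASL2 => Matrix.vecMul v g.lin.1 :=
  measurable_vecMul_lin.comp (measurable_id.prodMk measurable_const)

theorem measurable_act (v : ℝ²) : Measurable (act v) :=
  (measurable_vecMul_lin_left v).add measurable_shift

theorem continuous_mul_left (h : ASL2) : Continuous fun g : ASL2 => h * g := by
  have h0 : Continuous (fun h : ASL2 => (h.lin, h.shift)) := continuous_induced_dom
  refine continuous_induced_rng.2 ?_
  refine (continuous_const.mul h0.fst).prodMk (Continuous.add ?_ h0.snd)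
  exact continuous_const.matrix_vecMul (Continuous.comp continuous_subtype_val h0.fst)

theorem continuous_mul_right (h : ASL2) : Continuous fun g : ASL2 => g * h := by
  have h0 : Continuous (fun h : ASL2 => (h.lin, h.shift)) := continuous_induced_dom
  refine continuous_induced_rng.2 ?_
  exact (h0.fst.mul continuous_const).prodMk
    ((h0.snd.matrix_vecMul continuous_const).add continuous_const)

theorem isClosed_integerPoints : IsClosed (integerPoints : Set ASL2) := by
  have : (integerPoints : Set ASL2) =
      {g | (∀ i j, (toProd g).1 i j ∈ Set.range ((↑) : ℤ → ℝ)) ∧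
        ∀ i, (toProd g).2 i ∈ Set.range ((↑) : ℤ → ℝ)} := by
    ext g
    constructor
    · rintro ⟨γ, m, rfl⟩
      exact ⟨fun i j => ⟨γ.1 i j, by simp [toProd, ofInt]⟩, fun i => ⟨m i, rfl⟩⟩
    · rintro ⟨h1, h2⟩
      choose a ha using h1
      choose m hm using h2
      have hdet : (Matrix.of a).det = 1 := by
        have := g.lin.2
        rw [Matrix.det_fin_two] at this ⊢
        simp only [toProd] at ha
        rw [← ha, ← ha, ← ha, ← ha] at this
        exact_mod_cast this
      refine ⟨⟨Matrix.of a, hdet⟩, m, ?_⟩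
      ext1
      · ext i j
        exact (ha i j).symm
      · ext i
        exact (hm i).symm
  rw [this]
  have hc := isClosedEmbedding_toProd.continuous
  have hZ : IsClosed (Set.range ((↑) : ℤ → ℝ)) := Int.isClosedEmbedding_coe_real.isClosed_range
  simp only [Set.ofPred_and, Set.ofPred_forall]
  refine IsClosed.inter (isClosed_iInter fun i => isClosed_iInter fun j => ?_)
    (isClosed_iInter fun i => ?_)
  · exact hZ.preimage ((continuous_apply_apply i j).comp (continuous_fst.comp hc))
  · exact hZ.preimage ((continuous_apply i).comp (continuous_snd.comp hc))

instance : ContinuousConstSMul integerPoints ASL2 := ⟨fun h => continuous_mul_left (h : ASL2)⟩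

theorem ofInt_mem (γ : Matrix.SpecialLinearGroup (Fin 2) ℤ) (m : Fin 2 → ℤ) :
    ofInt γ m ∈ integerPoints := ⟨γ, m, rfl⟩

/-- Invariance of a function on `G'` under left multiplication by `Γ'`; such functions are the
functions on `X`. -/
def IsLeftInvariant {β : Type*} (Ψ : ASL2 → β) : Prop :=
  ∀ γ m g, Ψ (ofInt γ m * g) = Ψ g

theorem IsLeftInvariant.apply_mul {β : Type*} {Ψ : ASL2 → β} (h : IsLeftInvariant Ψ) {γ : ASL2}
    (hγ : γ ∈ integerPoints) (g : ASL2) : Ψ (γ * g) = Ψ g := by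
  obtain ⟨γ, m, rfl⟩ := hγ
  exact h γ m g

theorem IsLeftInvariant.mul_right {β : Type*} {Ψ : ASL2 → β} (h : IsLeftInvariant Ψ) (g : ASL2) :
    IsLeftInvariant fun a => Ψ (a * g) := fun γ m a => by
  simpa only [mul_assoc] using h γ m (a * g)

end ASL2

namespace AffineLatticeSpace

open ASL2

theorem isQuotientMap_mk : IsQuotientMap mk := ⟨⟨rfl⟩, Quotient.mk_surjective⟩

theorem isOpenMap_mk : IsOpenMap mk := isOpenMap_quotient_mk'_mul

theorem mk_eq_mk {a b : ASL2} : mk a = mk b ↔ a * b⁻¹ ∈ integerPoints := by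
  refine Quotient.eq.trans ?_
  rw [MulAction.orbitRel_apply]
  constructor
  · rintro ⟨γ, rfl⟩
    have : γ • b * b⁻¹ = γ := by
      rw [Subgroup.smul_def, smul_eq_mul, mul_inv_cancel_right]
    simp only [this]
    exact γ.2
  · intro h
    exact ⟨⟨_, h⟩, by simp [Subgroup.smul_def]⟩

instance : SecondCountableTopology AffineLatticeSpace :=
  isQuotientMap_mk.secondCountableTopology isOpenMap_mk

instance : T1Space AffineLatticeSpace := by
  refine ⟨fun x => ?_⟩
  obtain ⟨b, rfl⟩ := isQuotientMap_mk.surjective x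
  rw [← isQuotientMap_mk.isClosed_preimage]
  have : mk ⁻¹' {mk b} = (fun a => a * b⁻¹) ⁻¹' (integerPoints : Set ASL2) := by
    ext a
    exact mk_eq_mk
  rw [this]
  exact isClosed_integerPoints.preimage (continuous_mul_right _)

/-- A representative in `G'` of a point of `X`. It need not depend measurably on the point, but
`Γ'`-invariant measurable functions of it do. -/
noncomputable def rep (x : AffineLatticeSpace) : ASL2 := Quotient.out x

@[simp]
theorem mk_rep (x : AffineLatticeSpace) : mk (rep x) = x := Quotient.out_eq x

theorem translate_mk (g h : ASL2) : translate g (mk h) = mk (h * g) := rfl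

theorem _root_.ASL2.IsLeftInvariant.eq_of_mk_eq {β : Type*} {Ψ : ASL2 → β} (h : IsLeftInvariant Ψ)
    {a b : ASL2} (hab : mk a = mk b) : Ψ a = Ψ b := by
  have := h.apply_mul (mk_eq_mk.1 hab) b
  rwa [inv_mul_cancel_right] at this

theorem _root_.ASL2.IsLeftInvariant.rep_mk {β : Type*} {Ψ : ASL2 → β} (h : IsLeftInvariant Ψ)
    (g : ASL2) : Ψ (rep (mk g)) = Ψ g :=
  h.eq_of_mk_eq (mk_rep _)

/-- By the Lusin–Souslin theorem, the Borel σ-algebra of the quotient `X × Y` of `G' × Y` is the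
quotient σ-algebra; hence invariant measurable functions descend to measurable functions. -/
theorem measurable_uncurry_rep {Y β : Type*} [TopologicalSpace Y] [PolishSpace Y]
    [MeasurableSpace Y] [BorelSpace Y] [MeasurableSpace β] {Ψ : ASL2 → Y → β}
    (hΨ : Measurable (Function.uncurry Ψ)) (hinv : ∀ y, IsLeftInvariant fun g => Ψ g y) :
    Measurable fun p : AffineLatticeSpace × Y => Ψ (rep p.1) p.2 := by
  have hc : Continuous (Prod.map mk (id : Y → Y)) :=
    isQuotientMap_mk.continuous.prodMap continuous_id
  have hs : Function.Surjective (Prod.map mk (id : Y → Y)) :=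
    isQuotientMap_mk.surjective.prodMap Function.surjective_id
  have key := hc.map_eq_borel hs
  intro s hs
  rw [BorelSpace.measurable_eq (α := AffineLatticeSpace × Y), ← key]
  change MeasurableSet ((Prod.map mk (id : Y → Y)) ⁻¹' _)
  convert hΨ hs using 1
  ext ⟨g, y⟩
  simp only [Set.mem_preimage, Prod.map, id, Function.uncurry]
  rw [(hinv y).rep_mk g]

theorem measurable_comp_rep {β : Type*} [MeasurableSpace β] {Ψ : ASL2 → β} (hΨ : Measurable Ψ)
    (hinv : IsLeftInvariant Ψ) : Measurable fun x => Ψ (rep x) :=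
  (measurable_uncurry_rep (Y := Unit) (Ψ := fun g _ => Ψ g) (hΨ.comp measurable_fst)
    (fun _ => hinv)).comp (measurable_id.prodMk (measurable_const (a := ())))

theorem measurable_translate (g : ASL2) : Measurable (translate g) :=
  (continuous_translate g).measurable

theorem measurable_mk : Measurable mk := isQuotientMap_mk.continuous.measurable

variable {μ : Measure AffineLatticeSpace}

theorem IsHaarProbability.lintegral_rep_mul (hμ : IsHaarProbability μ) {Ψ : ASL2 → ENNReal}
    (hΨ : Measurable Ψ) (hinv : IsLeftInvariant Ψ) (g : ASL2) :
    ∫⁻ x, Ψ (rep x * g) ∂μ = ∫⁻ x, Ψ (rep x) ∂μ := by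
  conv_rhs => rw [← hμ.map_translate g]
  rw [lintegral_map (measurable_comp_rep hΨ hinv) (measurable_translate g)]
  refine lintegral_congr fun x => ?_
  conv_rhs => rw [← mk_rep x, translate_mk, hinv.rep_mk]

end AffineLatticeSpace

end BorelStructure

/-! ### Averaging over translations -/

section Averaging

open scoped MatrixGroups ENNReal

local notation "ℝ²" => (Fin 2 → ℝ)

namespace ASL2

theorem intVec_add (m n : Fin 2 → ℤ) : intVec (m + n) = intVec m + intVec n := by
  ext i; simp [intVec]

theorem measurePreserving_vecMul (M : SL(2, ℝ)) :
    MeasurePreserving (fun v : ℝ² => Matrix.vecMul v M.1) volume volume := by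
  refine ⟨measurable_vecMul_lin.comp (measurable_const (a := (⟨M, 0⟩ : ASL2)).prodMk
    measurable_id), ?_⟩
  have h := Real.map_matrix_volume_pi_eq_smul_volume_pi (M := M.1.transpose)
    (by rw [Matrix.det_transpose, M.2]; exact one_ne_zero)
  rw [Matrix.det_transpose, M.2] at h
  have h' : ⇑(Matrix.toLin' M.1.transpose) = fun v : ℝ² => Matrix.vecMul v M.1 := by
    ext v : 1
    rw [Matrix.toLin'_apply, Matrix.mulVec_transpose]
  rw [h'] at h
  simpa using h

theorem lintegral_vecMul (M : SL(2, ℝ)) {f : ℝ² → ℝ≥0∞} (hf : Measurable f) :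
    ∫⁻ v, f (Matrix.vecMul v M.1) = ∫⁻ v, f v :=
  (measurePreserving_vecMul M).lintegral_comp hf

/-- The integer translates of the half-open unit square tile the plane. -/
theorem lintegral_eq_tsum_unitSquare (f : ℝ² → ℝ≥0∞) :
    ∫⁻ a, f a = ∑' m : Fin 2 → ℤ,
      ∫⁻ a in Set.univ.pi (fun _ : Fin 2 => Set.Ico (0 : ℝ) 1), f (intVec m + a) := by
  have hmeas : MeasurableSet (Set.univ.pi (fun _ : Fin 2 => Set.Ico (0 : ℝ) 1)) :=
    MeasurableSet.univ_pi fun _ => measurableSet_Ico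
  have hU : (⋃ m : Fin 2 → ℤ, {a : ℝ² | ∀ i, ⌊a i⌋ = m i}) = Set.univ :=
    Set.eq_univ_of_forall fun a => Set.mem_iUnion.2 ⟨fun i => ⌊a i⌋, fun _ => rfl⟩
  have hS (m : Fin 2 → ℤ) : MeasurableSet {a : ℝ² | ∀ i, ⌊a i⌋ = m i} := by
    have : {a : ℝ² | ∀ i, ⌊a i⌋ = m i} = ⋂ i, (fun a : ℝ² => ⌊a i⌋) ⁻¹' {m i} := by
      ext; simp
    rw [this]
    exact MeasurableSet.iInter fun i =>
      (Int.measurable_floor.comp (measurable_pi_apply i)) (measurableSet_singleton _)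
  rw [← setLIntegral_univ, ← hU, lintegral_iUnion hS]
  · refine tsum_congr fun m => ?_
    rw [← lintegral_indicator hmeas, ← lintegral_indicator (hS m),
      ← lintegral_add_left_eq_self _ (intVec m)]
    refine lintegral_congr fun a => ?_
    have : intVec m + a ∈ {a : ℝ² | ∀ i, ⌊a i⌋ = m i} ↔
        a ∈ Set.univ.pi (fun _ : Fin 2 => Set.Ico (0 : ℝ) 1) := by
      simp [intVec, Set.mem_pi, Int.floor_eq_zero_iff]
    by_cases h : a ∈ Set.univ.pi (fun _ : Fin 2 => Set.Ico (0 : ℝ) 1)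
    · rw [Set.indicator_of_mem h, Set.indicator_of_mem (this.2 h)]
    · rw [Set.indicator_of_notMem h, Set.indicator_of_notMem (fun h' => h (this.1 h'))]
  · intro m n hmn
    refine Set.disjoint_left.2 fun a ha hb => hmn (funext fun i => (ha i).symm.trans (hb i))

/-- A positive function on the plane with finite sums over all translated lattices. -/
noncomputable def decay (v : ℝ²) : ℝ≥0∞ := ENNReal.ofReal ((1 + ‖v‖) ^ (-3 : ℝ))

theorem decay_ne_zero (v : ℝ²) : decay v ≠ 0 := by
  have : 0 < (1 + ‖v‖) ^ (-3 : ℝ) := by positivity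
  simpa [decay] using this

@[fun_prop]
theorem measurable_decay : Measurable decay := by
  unfold decay
  fun_prop

theorem norm_vecMul_le (A : Matrix (Fin 2) (Fin 2) ℝ) :
    ∃ K : ℝ, 0 ≤ K ∧ ∀ v : ℝ², ‖Matrix.vecMul v A‖ ≤ K * ‖v‖ := by
  obtain ⟨K, hK⟩ := (LinearMap.toContinuousLinearMap (Matrix.vecMulLinear A)).bound
  exact ⟨K, hK.1.le, hK.2⟩

theorem norm_intVec (m : Fin 2 → ℤ) : ‖intVec m‖ = ‖m‖ := by
  simp only [Pi.norm_def, intVec]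
  congr 2

/-- The sum of `decay` over the translated lattice `ℤ² M + t`. -/
noncomputable def latticeSum (M : SL(2, ℝ)) (t : ℝ²) : ℝ≥0∞ :=
  ∑' m : Fin 2 → ℤ, decay (Matrix.vecMul (intVec m) M.1 + t)

theorem latticeSum_ne_zero (M : SL(2, ℝ)) (t : ℝ²) : latticeSum M t ≠ 0 := by
  intro h
  exact decay_ne_zero _ (ENNReal.tsum_eq_zero.1 h 0)

theorem vecMul_vecMul_inv (M : SL(2, ℝ)) (v : ℝ²) :
    Matrix.vecMul (Matrix.vecMul v M.1) (M⁻¹).1 = v := by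
  rw [Matrix.vecMul_vecMul, ← Matrix.SpecialLinearGroup.coe_mul, mul_inv_cancel,
    Matrix.SpecialLinearGroup.coe_one, Matrix.vecMul_one]

theorem latticeSum_ne_top (M : SL(2, ℝ)) (t : ℝ²) : latticeSum M t ≠ ∞ := by
  obtain ⟨K, hK0, hK⟩ := norm_vecMul_le (M⁻¹).1
  have hs : Summable fun m : Fin 2 → ℤ => (1 + ‖m‖) ^ (-3 : ℝ) := by
    refine ((EisensteinSeries.summable_one_div_norm_rpow (k := 3) (by norm_num)).add
      (summable_of_ne_finset_zero (s := {(0 : Fin 2 → ℤ)})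
        (f := fun m => if m = 0 then (1 : ℝ) else 0) fun b hb =>
          if_neg (by simpa using hb))).of_nonneg_of_le
      (fun m => by positivity) fun m => ?_
    by_cases hm : m = 0
    · simp [hm]
    · have : 0 < ‖m‖ := norm_pos_iff.2 hm
      simp only [hm, if_false, add_zero]
      exact Real.rpow_le_rpow_of_nonpos this (by linarith) (by norm_num)
  -- `‖m‖` is at most a constant times `1 + ‖m M + t‖`, because `m = (m M + t) M⁻¹ - t M⁻¹`.
  have hC (m : Fin 2 → ℤ) :
      (1 + ‖m‖) ≤ (1 + K + K * ‖t‖) * (1 + ‖Matrix.vecMul (intVec m) M.1 + t‖) := by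
    have h1 : intVec m = Matrix.vecMul (Matrix.vecMul (intVec m) M.1 + t) (M⁻¹).1 -
        Matrix.vecMul t (M⁻¹).1 := by
      rw [Matrix.add_vecMul, vecMul_vecMul_inv, add_sub_cancel_right]
    have h2 : ‖m‖ ≤ K * ‖Matrix.vecMul (intVec m) M.1 + t‖ + K * ‖t‖ := by
      rw [← norm_intVec]
      conv_lhs => rw [h1]
      exact (norm_sub_le _ _).trans (add_le_add (hK _) (hK _))
    have := norm_nonneg (Matrix.vecMul (intVec m) M.1 + t)
    have := norm_nonneg t
    nlinarith [mul_nonneg (mul_nonneg hK0 (norm_nonneg t))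
      (norm_nonneg (Matrix.vecMul (intVec m) M.1 + t))]
  have hc : 0 < 1 + K + K * ‖t‖ := by positivity
  have hb (m : Fin 2 → ℤ) : (1 + ‖Matrix.vecMul (intVec m) M.1 + t‖) ^ (-3 : ℝ) ≤
      (1 + K + K * ‖t‖) ^ (3 : ℝ) * (1 + ‖m‖) ^ (-3 : ℝ) := by
    have := Real.rpow_le_rpow_of_nonpos (z := -3) (by positivity) (hC m) (by norm_num)
    rw [Real.mul_rpow hc.le (by positivity), Real.rpow_neg hc.le] at this
    have h3 : 0 < (1 + K + K * ‖t‖) ^ (3 : ℝ) := by positivity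
    rwa [inv_mul_le_iff₀ h3] at this
  have hsum : Summable fun m : Fin 2 → ℤ => (1 + ‖Matrix.vecMul (intVec m) M.1 + t‖) ^ (-3 : ℝ) :=
    (hs.mul_left _).of_nonneg_of_le (fun m => by positivity) hb
  unfold latticeSum decay
  exact hsum.tsum_ofReal_ne_top

theorem latticeSum_add (M : SL(2, ℝ)) (n : Fin 2 → ℤ) (t : ℝ²) :
    latticeSum M (Matrix.vecMul (intVec n) M.1 + t) = latticeSum M t := by
  refine (tsum_congr fun m => ?_).trans ((Equiv.addRight n).tsum_eq fun m =>
    decay (Matrix.vecMul (intVec m) M.1 + t))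
  simp only [Equiv.coe_addRight, intVec_add, Matrix.add_vecMul, add_assoc]

theorem vecMul_map_mul (m : Fin 2 → ℤ) (γ : SL(2, ℤ)) (M : SL(2, ℝ)) :
    Matrix.vecMul (intVec m) (γ.map (Int.castRingHom ℝ) * M).1 =
      Matrix.vecMul (intVec (Matrix.vecMul m γ.1)) M.1 := by
  rw [Matrix.SpecialLinearGroup.coe_mul, ← Matrix.vecMul_vecMul]
  congr 1
  exact vecMul_intVec m γ

/-- The permutation `m ↦ m γ` of `ℤ²`. -/
noncomputable def vecMulEquiv (γ : SL(2, ℤ)) : (Fin 2 → ℤ) ≃ (Fin 2 → ℤ) :=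
  Equiv.ofBijective (fun n => Matrix.vecMul n γ.1)
    (by simpa using act_intVec_ofInt_bijective γ 0)

theorem latticeSum_map_mul (γ : SL(2, ℤ)) (M : SL(2, ℝ)) (t : ℝ²) :
    latticeSum (γ.map (Int.castRingHom ℝ) * M) t = latticeSum M t := by
  exact (tsum_congr fun m => by rw [vecMul_map_mul]; rfl).trans ((vecMulEquiv γ).tsum_eq fun m =>
    decay (Matrix.vecMul (intVec m) M.1 + t))

/-- A partition of unity for the translates of the plane by the lattice `ℤ² M`. It plays the role
of a fundamental domain, and depends on the lattice only. -/
noncomputable def weight (M : SL(2, ℝ)) (t : ℝ²) : ℝ≥0∞ := decay t / latticeSum M t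

theorem weight_map_mul (γ : SL(2, ℤ)) (M : SL(2, ℝ)) (t : ℝ²) :
    weight (γ.map (Int.castRingHom ℝ) * M) t = weight M t := by
  rw [weight, weight, latticeSum_map_mul]

theorem tsum_weight (M : SL(2, ℝ)) (t : ℝ²) :
    ∑' m : Fin 2 → ℤ, weight M (Matrix.vecMul (intVec m) M.1 + t) = 1 := by
  simp only [weight, latticeSum_add, div_eq_mul_inv]
  rw [ENNReal.tsum_mul_right]
  exact ENNReal.mul_inv_cancel (latticeSum_ne_zero M t) (latticeSum_ne_top M t)

theorem measurable_latticeSum : Measurable fun p : ASL2 × ℝ² => latticeSum p.1.lin p.2 := by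
  refine Measurable.tsum fun m => measurable_decay.comp ?_
  exact ((measurable_vecMul_lin_left _).comp measurable_fst).add measurable_snd

theorem measurable_weight : Measurable fun p : ASL2 × ℝ² => weight p.1.lin p.2 :=
  (measurable_decay.comp measurable_snd).div measurable_latticeSum

theorem measurable_weight_right (M : SL(2, ℝ)) : Measurable (weight M) := by
  have h := measurable_weight.comp (measurable_prodMk_left (x := (⟨M, 0⟩ : ASL2)))
  exact h

/-- The lattice `ℤ² M` has covolume one. -/
theorem lintegral_weight (M : SL(2, ℝ)) : ∫⁻ t, weight M t = 1 := by
  have hw := measurable_weight_right M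
  have hv : Measurable fun v : ℝ² => Matrix.vecMul v M.1 := (measurePreserving_vecMul M).measurable
  rw [← lintegral_vecMul M hw, lintegral_eq_tsum_unitSquare, ← lintegral_tsum]
  · simp only [Matrix.add_vecMul, tsum_weight]
    simp [Real.volume_pi_Ico]
  · intro m
    exact (hw.comp (hv.comp (measurable_const.add measurable_id))).aemeasurable

/-- The translation by `t`, as an element of `G'`. -/
def translation (t : ℝ²) : ASL2 := ⟨1, t⟩

@[simp] theorem translation_lin (t : ℝ²) : (translation t).lin = 1 := rfl

theorem act_translation (y t : ℝ²) : act y (translation t) = t + y := by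
  simp [act, translation, add_comm]

theorem measurable_mul_translation : Measurable fun p : ASL2 × ℝ² => p.1 * translation p.2 := by
  have h : (fun p : ASL2 × ℝ² => p.1 * translation p.2) =
      fun p => ⟨p.1.lin, p.1.shift + p.2⟩ := by
    funext p
    exact ASL2.ext (mul_one _) (by simp [translation])
  rw [h]
  exact ASL2.measurable_mk (fun i j => (measurable_lin_apply i j).comp measurable_fst)
    ((measurable_shift.comp measurable_fst).add measurable_snd)

/-- Unfolding: the sum over the lattice points and the integral over a fundamental domain of the
lattice, encoded by `weight`, combine to an integral over the plane. -/
theorem lintegral_tsum_mul_weight (g : ASL2) {H : ℝ² → ℝ≥0∞} (hH : Measurable H) :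
    ∫⁻ t, (∑' m : Fin 2 → ℤ, H (t + act (intVec m) g)) * weight g.lin t = ∫⁻ s, H s := by
  have hwg := measurable_weight_right g.lin
  calc ∫⁻ t, (∑' m : Fin 2 → ℤ, H (t + act (intVec m) g)) * weight g.lin t
      = ∫⁻ t, ∑' m : Fin 2 → ℤ, H (t + act (intVec m) g) * weight g.lin t :=
        lintegral_congr fun t => ENNReal.tsum_mul_right.symm
    _ = ∑' m : Fin 2 → ℤ, ∫⁻ t, H (t + act (intVec m) g) * weight g.lin t :=
        lintegral_tsum fun m => by fun_prop
    _ = ∑' m : Fin 2 → ℤ, ∫⁻ s, H s * weight g.lin (s - act (intVec m) g) := by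
        refine tsum_congr fun m => ?_
        rw [← lintegral_add_right_eq_self (fun s => H s * weight g.lin (s - act (intVec m) g))
          (act (intVec m) g)]
        simp only [add_sub_cancel_right]
    _ = ∫⁻ s, ∑' m : Fin 2 → ℤ, H s * weight g.lin (s - act (intVec m) g) := by
        rw [lintegral_tsum fun m => by fun_prop]
    _ = ∫⁻ s, H s := by
        refine lintegral_congr fun s => ?_
        rw [ENNReal.tsum_mul_left]
        convert mul_one _
        rw [← tsum_weight g.lin (s - g.shift), ← (Equiv.neg _).tsum_eq]
        refine tsum_congr fun m => ?_
        congr 1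
        have : intVec (-m) = -intVec m := by ext i; simp [intVec]
        simp only [act, Equiv.neg_apply, this, Matrix.neg_vecMul]
        abel

end ASL2

namespace AffineLatticeSpace

open ASL2

variable {μ : Measure AffineLatticeSpace}

/-- The average over translations of a `Γ'`-invariant function, weighted with the partition of
unity of the lattice, has the same integral as the function. -/
theorem IsHaarProbability.lintegral_eq_lintegral_lintegral_weight (hμ : IsHaarProbability μ)
    {G : ASL2 → ℝ≥0∞} (hGm : Measurable G) (hGi : IsLeftInvariant G) :
    ∫⁻ x, G (rep x) ∂μ = ∫⁻ x, (∫⁻ t, G (rep x * translation t) * weight (rep x).lin t) ∂μ := by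
  have := hμ.isProbabilityMeasure
  have hW (t : ℝ²) : IsLeftInvariant fun g : ASL2 => weight g.lin t := fun γ m g =>
    weight_map_mul γ _ _
  have hWm : Measurable fun p : AffineLatticeSpace × ℝ² => weight (rep p.1).lin p.2 :=
    measurable_uncurry_rep (Ψ := fun g t => weight g.lin t) measurable_weight hW
  have hWt (t : ℝ²) : Measurable fun g : ASL2 => weight g.lin t := by
    have h := measurable_weight.comp (measurable_prodMk_right (y := t))
    exact h
  have hGt : Measurable fun p : AffineLatticeSpace × ℝ² => G (rep p.1 * translation p.2) := by
    have h : Measurable (Function.uncurry fun g t => G (g * translation t)) :=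
      hGm.comp measurable_mul_translation
    exact measurable_uncurry_rep h fun t => hGi.mul_right _
  calc ∫⁻ x, G (rep x) ∂μ = ∫⁻ x, (∫⁻ t, G (rep x) * weight (rep x).lin t) ∂μ := by
        refine lintegral_congr fun x => ?_
        rw [lintegral_const_mul _ (measurable_weight_right _), lintegral_weight, mul_one]
    _ = ∫⁻ t, ∫⁻ x, G (rep x) * weight (rep x).lin t ∂μ := by
        refine lintegral_lintegral_swap (Measurable.aemeasurable ?_)
        exact ((measurable_comp_rep hGm hGi).comp measurable_fst).mul hWm
    _ = ∫⁻ t, ∫⁻ x, G (rep x * translation t) * weight (rep x).lin t ∂μ := by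
        refine lintegral_congr fun t => ?_
        have hΨi : IsLeftInvariant fun g : ASL2 => G g * weight g.lin t := fun γ m g => by
          simp only [hGi γ m g, hW t γ m g]
        have := hμ.lintegral_rep_mul (hGm.mul (hWt t)) hΨi (translation t)
        simp only [mul_lin, translation_lin, mul_one, Pi.mul_apply] at this
        exact this.symm
    _ = ∫⁻ x, (∫⁻ t, G (rep x * translation t) * weight (rep x).lin t) ∂μ := by
        symm
        refine lintegral_lintegral_swap (Measurable.aemeasurable (hGt.mul hWm))

/-- Invariance of `μ` under translations makes the points of the affine lattice `ℤ² M + ξ`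
uniformly distributed: a sum over these points may be replaced by an integral over the plane, even
if the summand depends on the lattice `ℤ² M`. -/
theorem IsHaarProbability.lintegral_tsum_act (hμ : IsHaarProbability μ)
    {H : SL(2, ℝ) → ℝ² → ℝ≥0∞} (hH : Measurable fun p : ASL2 × ℝ² => H p.1.lin p.2)
    (hinv : ∀ γ : SL(2, ℤ), ∀ M s, H (γ.map (Int.castRingHom ℝ) * M) s = H M s) :
    ∫⁻ x, ∑' m : Fin 2 → ℤ, H (rep x).lin (act (intVec m) (rep x)) ∂μ =
      ∫⁻ x, (∫⁻ s, H (rep x).lin s) ∂μ := by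
  have hGm : Measurable fun g : ASL2 => ∑' m : Fin 2 → ℤ, H g.lin (act (intVec m) g) := by
    refine Measurable.tsum fun m => ?_
    have h := hH.comp (measurable_id.prodMk (measurable_act (intVec m)))
    exact h
  have hGi : IsLeftInvariant fun g : ASL2 => ∑' m : Fin 2 → ℤ, H g.lin (act (intVec m) g) :=
    fun γ m g => by
      simp only [act_mul, act_intVec_ofInt]
      rw [← (Equiv.ofBijective _ (act_intVec_ofInt_bijective γ m)).tsum_eq
        fun n => H g.lin (act (intVec n) g)]
      exact tsum_congr fun n => hinv γ _ _
  rw [hμ.lintegral_eq_lintegral_lintegral_weight hGm hGi]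
  refine lintegral_congr fun x => ?_
  have hHg : Measurable (H (rep x).lin) := by
    have h := hH.comp (measurable_prodMk_left (x := rep x))
    exact h
  rw [← lintegral_tsum_mul_weight (rep x) hHg]
  simp only [act_mul, mul_lin, translation_lin, mul_one, act_translation]

end AffineLatticeSpace

end Averaging

/-! ### Invariant measures on the plane -/

section InvariantMeasure

open scoped MatrixGroups ENNReal NNReal

local notation "ℝ²" => (Fin 2 → ℝ)

theorem lintegral_comp_add_mul (g : ℝ → ℝ≥0∞) (hg : Measurable g) {a : ℝ} (ha : a ≠ 0) (b : ℝ) :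
    ENNReal.ofReal |a| * ∫⁻ t, g (b + a * t) = ∫⁻ s, g s := by
  rw [← lintegral_add_left_eq_self g b]
  conv_rhs => rw [← Real.smul_map_volume_mul_left ha]
  rw [lintegral_smul_measure, lintegral_map (by fun_prop) (by fun_prop), smul_eq_mul]

/-- The upper unipotent matrix with entry `t`. -/
def upperUnipotent (t : ℝ) : SL(2, ℝ) := ⟨!![1, t; 0, 1], by simp⟩

/-- The lower unipotent matrix with entry `t`. -/
def lowerUnipotent (t : ℝ) : SL(2, ℝ) := ⟨!![1, 0; t, 1], by simp⟩

/-- The rotation by a right angle. -/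
def quarterTurn : SL(2, ℝ) := ⟨!![0, 1; -1, 0], by simp⟩

theorem vecMul_upperUnipotent (v : ℝ²) (t : ℝ) :
    Matrix.vecMul v (upperUnipotent t).1 = ![v 0, v 1 + v 0 * t] := by
  ext i
  fin_cases i <;> simp [upperUnipotent, Matrix.vecMul, dotProduct, add_comm]

theorem vecMul_lowerUnipotent (v : ℝ²) (t : ℝ) :
    Matrix.vecMul v (lowerUnipotent t).1 = ![v 0 + v 1 * t, v 1] := by
  ext i
  fin_cases i <;> simp [lowerUnipotent, Matrix.vecMul, dotProduct]

theorem vecMul_quarterTurn (v : ℝ²) : Matrix.vecMul v quarterTurn.1 = ![-v 1, v 0] := by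
  ext i
  fin_cases i <;> simp [quarterTurn, Matrix.vecMul, dotProduct]

variable {ρ : Measure ℝ²}

theorem lintegral_vecMul_of_map_eq (hinv : ∀ M : SL(2, ℝ), ρ.map (Matrix.vecMul · M.1) = ρ)
    (M : SL(2, ℝ)) {f : ℝ² → ℝ≥0∞} (hf : Measurable f) :
    ∫⁻ v, f (Matrix.vecMul v M.1) ∂ρ = ∫⁻ v, f v ∂ρ := by
  conv_rhs => rw [← hinv M]
  rw [lintegral_map hf (ASL2.measurePreserving_vecMul M).measurable]

theorem measurable_finTwo {α : Type*} [MeasurableSpace α] {a b : α → ℝ} (ha : Measurable a)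
    (hb : Measurable b) : Measurable fun x => (![a x, b x] : ℝ²) := by
  refine measurable_pi_lambda _ fun i => ?_
  fin_cases i
  · exact ha
  · exact hb

/-- The lines through the origin other than the first axis are permuted transitively by the lower
unipotent matrices; there are too many of them to have positive measure. -/
theorem measure_axis_eq_zero [SigmaFinite ρ] (h0 : ρ {0} = 0)
    (hinv : ∀ M : SL(2, ℝ), ρ.map (Matrix.vecMul · M.1) = ρ) : ρ {v | v 0 = 0} = 0 := by
  have hm0 : Measurable fun v : ℝ² => v 0 := measurable_pi_apply 0
  set A : Set ℝ² := {v | v 0 = 0} \ {0} with hA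
  have hAm : MeasurableSet A := (hm0 (measurableSet_singleton 0)).diff (measurableSet_singleton 0)
  set f : ℝ² → ℝ≥0∞ := A.indicator 1 with hf
  have hfm : Measurable f := measurable_one.indicator hAm
  have h1 (t : ℝ) : ∫⁻ v, f (Matrix.vecMul v (lowerUnipotent t).1) ∂ρ = ρ A := by
    rw [lintegral_vecMul_of_map_eq hinv _ hfm, hf, lintegral_indicator_one hAm]
  have h2 : ∫⁻ t : ℝ, ∫⁻ v, f (Matrix.vecMul v (lowerUnipotent t).1) ∂ρ = 0 := by
    rw [lintegral_lintegral_swap]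
    · refine (lintegral_congr fun v => ?_).trans lintegral_zero
      refine (lintegral_eq_zero_iff' ?_).2 ?_
      · simp only [vecMul_lowerUnipotent]
        exact (hfm.comp (measurable_finTwo (by fun_prop) (by fun_prop))).aemeasurable
      by_cases hv : v 1 = 0
      · refine Filter.Eventually.of_forall fun t => Set.indicator_of_notMem ?_ _
        rw [vecMul_lowerUnipotent, hv]
        rintro ⟨h3, h4⟩
        refine h4 ?_
        simp only [Set.mem_ofPred_eq, Matrix.cons_val_zero] at h3
        rw [h3]
        ext i
        fin_cases i <;> rfl
      · have : ∀ᵐ t : ℝ, t ≠ -v 0 / v 1 := by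
          simp [ae_iff]
        filter_upwards [this] with t ht
        refine Set.indicator_of_notMem ?_ _
        rw [vecMul_lowerUnipotent]
        rintro ⟨h3, -⟩
        simp only [Set.mem_ofPred_eq, Matrix.cons_val_zero] at h3
        exact ht (by rw [eq_div_iff hv]; linarith)
    · simp only [vecMul_lowerUnipotent]
      exact (hfm.comp (measurable_finTwo (by fun_prop) (by fun_prop))).aemeasurable
  simp only [h1, lintegral_const, Real.volume_univ] at h2
  have h3 : ρ A = 0 := by
    by_contra h
    exact absurd h2 (by simp [ENNReal.mul_top h])
  have : {v : ℝ² | v 0 = 0} ⊆ A ∪ {0} := fun v hv => by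
    by_cases h : v = 0
    · exact Or.inr h
    · exact Or.inl ⟨hv, h⟩
  exact measure_mono_null this (measure_union_null h3 h0)

/-- Off the axis, the shears act on the vertical lines as the full group of translations; this
determines the integral over vertical lines. -/
theorem lintegral_eq_of_shear [SigmaFinite ρ]
    (hinv : ∀ M : SL(2, ℝ), ρ.map (Matrix.vecMul · M.1) = ρ) {f : ℝ² → ℝ≥0∞} (hf : Measurable f)
    (hf0 : ∀ v, v 0 = 0 → f v = 0) :
    ∫⁻ v, f v ∂ρ =
      ∫⁻ v, (Set.Ico (0 : ℝ) 1).indicator 1 (v 1) * (∫⁻ s : ℝ, f ![v 0, s]) ∂ρ := by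
  set k : ℝ → ℝ≥0∞ := (Set.Ico (0 : ℝ) 1).indicator 1 with hk
  have hkm : Measurable k := measurable_one.indicator measurableSet_Ico
  have hk1 : ∫⁻ s, k s = 1 := by
    rw [hk, lintegral_indicator_one measurableSet_Ico]
    simp
  calc ∫⁻ v, f v ∂ρ
      = ∫⁻ v, (∫⁻ t : ℝ, f v * (ENNReal.ofReal |v 0| * k (v 1 + v 0 * t))) ∂ρ := by
        refine lintegral_congr fun v => ?_
        rw [lintegral_const_mul _ (by fun_prop), lintegral_const_mul _ (by fun_prop)]
        by_cases hv : v 0 = 0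
        · simp [hf0 v hv]
        · rw [lintegral_comp_add_mul k hkm hv, hk1, mul_one]
    _ = ∫⁻ t : ℝ, ∫⁻ v, f v * (ENNReal.ofReal |v 0| * k (v 1 + v 0 * t)) ∂ρ := by
        refine lintegral_lintegral_swap (Measurable.aemeasurable ?_)
        fun_prop
    _ = ∫⁻ t : ℝ, ∫⁻ v, f ![v 0, v 1 + v 0 * -t] * (ENNReal.ofReal |v 0| * k (v 1)) ∂ρ := by
        refine lintegral_congr fun t => ?_
        rw [← lintegral_vecMul_of_map_eq hinv (upperUnipotent (-t)) (by fun_prop)]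
        refine lintegral_congr fun v => ?_
        rw [vecMul_upperUnipotent]
        simp only [Matrix.cons_val_zero, Matrix.cons_val_one, mul_neg, neg_add_cancel_right]
    _ = ∫⁻ v, (∫⁻ t : ℝ, f ![v 0, v 1 + v 0 * -t] * (ENNReal.ofReal |v 0| * k (v 1))) ∂ρ := by
        refine lintegral_lintegral_swap (Measurable.aemeasurable ?_)
        refine Measurable.mul (hf.comp (measurable_finTwo ?_ ?_)) ?_ <;> fun_prop
    _ = ∫⁻ v, k (v 1) * (∫⁻ s : ℝ, f ![v 0, s]) ∂ρ := by
        refine lintegral_congr fun v => ?_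
        have hfv : Measurable fun s => f ![v 0, s] :=
          hf.comp (measurable_finTwo measurable_const measurable_id)
        have hfv' : Measurable fun t => f ![v 0, v 1 + v 0 * -t] :=
          hf.comp (measurable_finTwo (by fun_prop) (by fun_prop))
        rw [lintegral_mul_const _ hfv']
        by_cases hv : v 0 = 0
        · simp only [hv, abs_zero, ENNReal.ofReal_zero, zero_mul, mul_zero]
          simp only [hf0 ![0, _] rfl, lintegral_zero, mul_zero]
        · rw [← lintegral_comp_add_mul _ hfv (neg_ne_zero.2 hv) (v 1), abs_neg]
          simp only [neg_mul, mul_neg]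
          ring

theorem lintegral_add_vertical [SigmaFinite ρ] (h0 : ρ {0} = 0)
    (hinv : ∀ M : SL(2, ℝ), ρ.map (Matrix.vecMul · M.1) = ρ) {f : ℝ² → ℝ≥0∞} (hf : Measurable f)
    (a : ℝ) : ∫⁻ v, f (v + ![0, a]) ∂ρ = ∫⁻ v, f v ∂ρ := by
  have hax : MeasurableSet {v : ℝ² | v 0 ≠ 0} :=
    (measurable_pi_apply (X := fun _ : Fin 2 => ℝ) 0) (measurableSet_singleton (0 : ℝ)).compl
  have hae : ∀ᵐ v ∂ρ, v ∈ {v : ℝ² | v 0 ≠ 0} := by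
    rw [ae_iff]
    simpa using measure_axis_eq_zero h0 hinv
  set f' := {v : ℝ² | v 0 ≠ 0}.indicator f with hf'
  have hfm : Measurable f' := hf.indicator hax
  have hf0 (v : ℝ²) (hv : v 0 = 0) : f' v = 0 := Set.indicator_of_notMem (by simpa using hv) _
  have h1 : ∫⁻ v, f (v + ![0, a]) ∂ρ = ∫⁻ v, f' (v + ![0, a]) ∂ρ := by
    refine lintegral_congr_ae ?_
    filter_upwards [hae] with v hv
    rw [hf', Set.indicator_of_mem]
    simpa [Matrix.vecHead] using hv
  have h2 : ∫⁻ v, f v ∂ρ = ∫⁻ v, f' v ∂ρ := by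
    refine lintegral_congr_ae ?_
    filter_upwards [hae] with v hv
    rw [hf', Set.indicator_of_mem hv]
  rw [h1, h2, lintegral_eq_of_shear hinv hfm hf0,
    lintegral_eq_of_shear hinv (f := fun v => f' (v + ![0, a])) (by fun_prop)
      fun v hv => hf0 _ (by simpa using hv)]
  refine lintegral_congr fun v => ?_
  rw [← lintegral_add_right_eq_self (fun s => f' ![v 0, s]) a]
  simp

/-- Up to a constant, Lebesgue measure is the only measure on the plane without an atom at the
origin that is invariant under `SL(2, ℝ)`. -/
theorem eq_smul_volume_of_map_vecMul_eq [IsLocallyFiniteMeasure ρ] (h0 : ρ {0} = 0)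
    (hinv : ∀ M : SL(2, ℝ), ρ.map (Matrix.vecMul · M.1) = ρ) : ∃ c : ℝ≥0, ρ = c • volume := by
  have hV (a : ℝ) {f : ℝ² → ℝ≥0∞} (hf : Measurable f) :
      ∫⁻ v, f (v + ![0, a]) ∂ρ = ∫⁻ v, f v ∂ρ := lintegral_add_vertical h0 hinv hf a
  -- Horizontal translations are conjugate to vertical ones.
  have hH (a : ℝ) {f : ℝ² → ℝ≥0∞} (hf : Measurable f) :
      ∫⁻ v, f (v + ![a, 0]) ∂ρ = ∫⁻ v, f v ∂ρ := by
    have hJ : Measurable fun v : ℝ² => Matrix.vecMul v quarterTurn.1 :=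
      (ASL2.measurePreserving_vecMul _).measurable
    rw [← lintegral_vecMul_of_map_eq hinv quarterTurn (f := fun v => f (v + ![a, 0])) (by fun_prop),
      ← lintegral_vecMul_of_map_eq hinv quarterTurn hf,
      ← hV (-a) (f := fun v => f (Matrix.vecMul v quarterTurn.1)) (by fun_prop)]
    refine lintegral_congr fun v => ?_
    congr 1
    simp only [vecMul_quarterTurn]
    ext i
    fin_cases i <;> simp [add_comm]
  have : ρ.IsAddLeftInvariant := by
    refine ⟨fun w => ?_⟩
    ext s hs
    rw [← lintegral_indicator_one hs, ← lintegral_indicator_one hs]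
    have hm : Measurable (s.indicator (1 : ℝ² → ℝ≥0∞)) := measurable_one.indicator hs
    rw [lintegral_map hm (by fun_prop), ← hV (w 1) hm,
      ← hH (w 0) (f := fun v => s.indicator 1 (v + ![0, w 1])) (by fun_prop)]
    refine lintegral_congr fun v => ?_
    congr 1
    ext i
    fin_cases i <;> simp [Matrix.vecHead, Matrix.vecTail] <;> exact add_comm _ _
  exact ⟨_, Measure.isAddLeftInvariant_eq_smul ρ volume⟩

end InvariantMeasure

/-! ### The mean value over nonzero lattice vectors -/

section LatticeVectors

open scoped MatrixGroups ENNReal NNReal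

local notation "ℝ²" => (Fin 2 → ℝ)

open ASL2 EisensteinSeries

theorem intVec_smul (d : ℕ) (m : Fin 2 → ℤ) : intVec (d • m) = (d : ℝ) • intVec m := by
  ext i; simp [intVec]

/-- Every nonzero integer vector is uniquely a positive multiple of a primitive one. -/
theorem tsum_eq_tsum_tsum_primitive {f : (Fin 2 → ℤ) → ℝ≥0∞} (hf : f 0 = 0) :
    ∑' m, f m = ∑' d : ℕ, ∑' k : gammaSet 1 1 0, f (d • k.1) := by
  rw [← gammaSetDivGcdSigmaEquiv.symm.tsum_eq, ENNReal.tsum_sigma']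
  refine tsum_congr fun d => ?_
  simp only [gammaSetDivGcdSigmaEquiv_symm_eq]
  rcases Nat.eq_zero_or_pos d with rfl | hd
  · simp only [zero_smul, hf, tsum_zero, ENNReal.tsum_eq_zero]
    intro v
    rw [gammaSet_eq_gcd_mul_divIntMap v.2, zero_smul, hf]
  · have : NeZero d := ⟨hd.ne'⟩
    rw [← (gammaSetDivGcdEquiv d).tsum_eq]
    refine tsum_congr fun v => ?_
    rw [gammaSetDivGcdEquiv_eq, ← gammaSet_eq_gcd_mul_divIntMap v.2]

/-- The permutation of the primitive vectors given by `γ ∈ SL(2, ℤ)`. -/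
noncomputable def primitiveEquiv (γ : SL(2, ℤ)) : gammaSet 1 1 0 ≃ gammaSet 1 1 0 :=
  (vecMulEquiv γ).subtypeEquiv fun v => by
    rw [mem_gammaSet_one, mem_gammaSet_one]
    refine ⟨fun h => h.vecMulSL γ, fun h => ?_⟩
    have := h.vecMulSL γ⁻¹
    have h2 : Matrix.vecMul (vecMulEquiv γ v) (γ⁻¹).1 = v := by
      change Matrix.vecMul (Matrix.vecMul v γ.1) (γ⁻¹).1 = v
      rw [Matrix.vecMul_vecMul, ← Matrix.SpecialLinearGroup.coe_mul, mul_inv_cancel,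
        Matrix.SpecialLinearGroup.coe_one, Matrix.vecMul_one]
    rwa [h2] at this

theorem isLeftInvariant_tsum_primitive (f : ℝ² → ℝ≥0∞) : IsLeftInvariant fun g : ASL2 =>
    ∑' k : gammaSet 1 1 0, f (Matrix.vecMul (intVec k) g.lin.1) := fun γ m g => by
  simp only [mul_lin, ofInt, vecMul_map_mul]
  exact (primitiveEquiv γ).tsum_eq fun k : gammaSet 1 1 0 => f (Matrix.vecMul (intVec k) g.lin.1)

theorem measurable_tsum_primitive {f : ℝ² → ℝ≥0∞} (hf : Measurable f) : Measurable fun g : ASL2 =>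
    ∑' k : gammaSet 1 1 0, f (Matrix.vecMul (intVec k) g.lin.1) :=
  Measurable.tsum fun _ => hf.comp (measurable_vecMul_lin_left _)

theorem isLeftInvariant_tsum_lattice (f : ℝ² → ℝ≥0∞) : IsLeftInvariant fun g : ASL2 =>
    ∑' m : Fin 2 → ℤ, f (Matrix.vecMul (intVec m) g.lin.1) := fun γ m g => by
  simp only [mul_lin, ofInt, vecMul_map_mul]
  exact (vecMulEquiv γ).tsum_eq fun k => f (Matrix.vecMul (intVec k) g.lin.1)

theorem measurable_tsum_lattice {f : ℝ² → ℝ≥0∞} (hf : Measurable f) : Measurable fun g : ASL2 =>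
    ∑' m : Fin 2 → ℤ, f (Matrix.vecMul (intVec m) g.lin.1) :=
  Measurable.tsum fun _ => hf.comp (measurable_vecMul_lin_left _)

theorem vecMul_intVec_ne_zero (M : SL(2, ℝ)) {m : Fin 2 → ℤ} (hm : m ≠ 0) :
    Matrix.vecMul (intVec m) M.1 ≠ 0 := fun h => by
  have h1 := vecMul_vecMul_inv M (intVec m)
  rw [h, Matrix.zero_vecMul] at h1
  refine hm (funext fun i => ?_)
  have := congrFun h1 i
  simpa [intVec] using this.symm

/-- Primitive vectors that span a line are equal up to sign. -/
theorem eq_or_eq_neg_of_primitive {a b : Fin 2 → ℤ} (ha : IsCoprime (a 0) (a 1))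
    (hb : IsCoprime (b 0) (b 1)) (h : a 0 * b 1 = a 1 * b 0) : b = a ∨ b = -a := by
  obtain ⟨u, v, huv⟩ := ha
  set t := u * b 0 + v * b 1 with ht
  have h0 : b 0 = t * a 0 := by
    calc b 0 = (u * a 0 + v * a 1) * b 0 := by rw [huv, one_mul]
      _ = t * a 0 := by rw [ht]; linear_combination (-v) * h
  have h1 : b 1 = t * a 1 := by
    calc b 1 = (u * a 0 + v * a 1) * b 1 := by rw [huv, one_mul]
      _ = t * a 1 := by rw [ht]; linear_combination u * h
  have ht1 : IsUnit t := hb.isUnit_of_dvd' ⟨_, h0⟩ ⟨_, h1⟩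
  rcases Int.isUnit_iff.1 ht1 with h2 | h2
  · left
    ext i
    fin_cases i
    · simpa [h2] using h0
    · simpa [h2] using h1
  · right
    ext i
    fin_cases i
    · simpa [h2] using h0
    · simpa [h2] using h1

/-- Two vectors of a unimodular lattice of length less than `1 / 2` span a parallelogram of area
less than one, so they are parallel: there are at most two short primitive vectors. -/
theorem tsum_primitive_indicator_ball_le (M : SL(2, ℝ)) :
    ∑' k : gammaSet 1 1 0, (Metric.ball (0 : ℝ²) (1 / 2)).indicator (1 : ℝ² → ℝ≥0∞)
      (Matrix.vecMul (intVec k) M.1) ≤ 2 := by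
  classical
  by_cases hne : ∃ a : gammaSet 1 1 0, Matrix.vecMul (intVec a) M.1 ∈ Metric.ball (0 : ℝ²) (1 / 2)
  · obtain ⟨a, ha⟩ := hne
    have key (b : gammaSet 1 1 0)
        (hb : Matrix.vecMul (intVec b) M.1 ∈ Metric.ball (0 : ℝ²) (1 / 2)) :
        b.1 = a.1 ∨ b.1 = -a.1 := by
      refine eq_or_eq_neg_of_primitive ((mem_gammaSet_one _).1 a.2) ((mem_gammaSet_one _).1 b.2) ?_
      rw [mem_ball_zero_iff, pi_norm_lt_iff (by norm_num)] at ha hb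
      have a0 := abs_lt.1 (ha 0)
      have a1 := abs_lt.1 (ha 1)
      have b0 := abs_lt.1 (hb 0)
      have b1 := abs_lt.1 (hb 1)
      have hdet : ((a.1 0 * b.1 1 - a.1 1 * b.1 0 : ℤ) : ℝ) =
          Matrix.vecMul (intVec a) M.1 0 * Matrix.vecMul (intVec b) M.1 1 -
            Matrix.vecMul (intVec a) M.1 1 * Matrix.vecMul (intVec b) M.1 0 := by
        have hM := M.2
        rw [Matrix.det_fin_two] at hM
        simp only [Matrix.vecMul, dotProduct, Fin.sum_univ_two, intVec]
        push_cast
        linear_combination (-((a.1 0 : ℝ) * b.1 1 - a.1 1 * b.1 0)) * hM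
      have hlt : |((a.1 0 * b.1 1 - a.1 1 * b.1 0 : ℤ) : ℝ)| < 1 := by
        rw [hdet, abs_lt]
        constructor <;> nlinarith
      have h0 : a.1 0 * b.1 1 - a.1 1 * b.1 0 = 0 := by
        rw [← Int.abs_lt_one_iff]
        exact_mod_cast hlt
      linarith
    calc _ ≤ ∑' k : gammaSet 1 1 0, ((if k.1 = a.1 then 1 else 0) +
          (if k.1 = -a.1 then 1 else 0) : ℝ≥0∞) := by
          refine ENNReal.tsum_le_tsum fun b => ?_
          by_cases hb : Matrix.vecMul (intVec b) M.1 ∈ Metric.ball (0 : ℝ²) (1 / 2)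
          · rw [Set.indicator_of_mem hb]
            rcases key b hb with h | h
            · simp [h]
            · simp [h]
          · rw [Set.indicator_of_notMem hb]
            exact zero_le
      _ ≤ ∑' k : Fin 2 → ℤ, ((if k = a.1 then 1 else 0) + (if k = -a.1 then 1 else 0) : ℝ≥0∞) :=
          ENNReal.tsum_comp_le_tsum_of_injective Subtype.val_injective
            (fun k : Fin 2 → ℤ => ((if k = a.1 then 1 else 0) + (if k = -a.1 then 1 else 0) : ℝ≥0∞))
      _ = 2 := by
          rw [ENNReal.tsum_add, tsum_ite_eq, tsum_ite_eq, one_add_one_eq_two]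
  · push Not at hne
    refine le_of_eq_of_le ?_ zero_le
    exact ENNReal.tsum_eq_zero.2 fun k => Set.indicator_of_notMem (hne k) _

namespace AffineLatticeSpace

/-- The expected number of primitive vectors of a random lattice in a set. -/
noncomputable def primitiveMeasure (μ : Measure AffineLatticeSpace) : Measure ℝ² :=
  μ.bind fun x => Measure.sum fun k : gammaSet 1 1 0 =>
    Measure.dirac (Matrix.vecMul (intVec k) (rep x).lin.1)

variable {μ : Measure AffineLatticeSpace}

theorem lintegral_primitiveMeasure {f : ℝ² → ℝ≥0∞} (hf : Measurable f) :
    ∫⁻ v, f v ∂primitiveMeasure μ =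
      ∫⁻ x, ∑' k : gammaSet 1 1 0, f (Matrix.vecMul (intVec k) (rep x).lin.1) ∂μ := by
  rw [primitiveMeasure, Measure.lintegral_bind _ hf.aemeasurable]
  · simp only [lintegral_sum_measure, lintegral_dirac' _ hf]
  · refine (Measure.measurable_of_measurable_coe _ fun s hs => ?_).aemeasurable
    simp only [Measure.sum_apply _ hs, Measure.dirac_apply' _ hs]
    exact measurable_comp_rep (measurable_tsum_primitive (measurable_one.indicator hs))
      (isLeftInvariant_tsum_primitive _)

theorem IsHaarProbability.map_primitiveMeasure (hμ : IsHaarProbability μ) (M : SL(2, ℝ)) :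
    (primitiveMeasure μ).map (Matrix.vecMul · M.1) = primitiveMeasure μ := by
  have hM : Measurable fun v : ℝ² => Matrix.vecMul v M.1 := (measurePreserving_vecMul M).measurable
  ext s hs
  have hm : Measurable (s.indicator (1 : ℝ² → ℝ≥0∞)) := measurable_one.indicator hs
  rw [← lintegral_indicator_one hs, ← lintegral_indicator_one hs, lintegral_map hm hM,
    lintegral_primitiveMeasure hm,
    lintegral_primitiveMeasure (f := fun v => s.indicator 1 (Matrix.vecMul v M.1)) (hm.comp hM),
    ← hμ.lintegral_rep_mul (measurable_tsum_primitive hm) (isLeftInvariant_tsum_primitive _) ⟨M, 0⟩]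
  simp only [mul_lin, Matrix.SpecialLinearGroup.coe_mul, Matrix.vecMul_vecMul]

theorem primitiveMeasure_zero : primitiveMeasure μ {0} = 0 := by
  have hs : MeasurableSet ({0} : Set ℝ²) := measurableSet_singleton 0
  rw [← lintegral_indicator_one hs, lintegral_primitiveMeasure (measurable_one.indicator hs)]
  refine (lintegral_congr fun x => ?_).trans lintegral_zero
  refine ENNReal.tsum_eq_zero.2 fun k => Set.indicator_of_notMem (fun h => ?_) _
  refine vecMul_intVec_ne_zero _ (fun h0 => ?_) h
  have := (mem_gammaSet_one _).1 k.2
  rw [h0] at this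
  exact not_isCoprime_zero_zero this

theorem IsHaarProbability.primitiveMeasure_ball_le (hμ : IsHaarProbability μ) :
    primitiveMeasure μ (Metric.ball 0 (1 / 2)) ≤ 2 := by
  have := hμ.isProbabilityMeasure
  have hs : MeasurableSet (Metric.ball (0 : ℝ²) (1 / 2)) := measurableSet_ball
  rw [← lintegral_indicator_one hs, lintegral_primitiveMeasure (measurable_one.indicator hs)]
  calc _ ≤ ∫⁻ _, 2 ∂μ := lintegral_mono fun x => tsum_primitive_indicator_ball_le _
    _ = 2 := by simp

/-- Every vector can be moved into a given neighbourhood of the origin by `SL(2, ℝ)`. -/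
theorem exists_vecMul_mem_ball (v : ℝ²) :
    ∃ M : SL(2, ℝ), Matrix.vecMul v M.1 ∈ Metric.ball (0 : ℝ²) (1 / 2) := by
  by_cases hv : v = 0
  · exact ⟨1, by simp [hv]⟩
  have hn : v 0 ^ 2 + v 1 ^ 2 ≠ 0 := fun h => hv <| by
    have h0 : v 0 = 0 := by nlinarith [sq_nonneg (v 0), sq_nonneg (v 1)]
    have h1 : v 1 = 0 := by nlinarith [sq_nonneg (v 0), sq_nonneg (v 1)]
    ext i
    fin_cases i
    · exact h0
    · exact h1
  -- The first column makes the first coordinate `1 / 4`, the second one is orthogonal to `v`.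
  refine ⟨⟨!![v 0 / (4 * (v 0 ^ 2 + v 1 ^ 2)), -4 * v 1; v 1 / (4 * (v 0 ^ 2 + v 1 ^ 2)), 4 * v 0],
    ?_⟩, ?_⟩
  · rw [Matrix.det_fin_two_of]
    field_simp
    ring
  · have h : Matrix.vecMul v !![v 0 / (4 * (v 0 ^ 2 + v 1 ^ 2)), -4 * v 1;
        v 1 / (4 * (v 0 ^ 2 + v 1 ^ 2)), 4 * v 0] = ![1 / 4, 0] := by
      ext i
      fin_cases i
      · simp [Matrix.vecMul, dotProduct]
        field_simp
      · simp [Matrix.vecMul, dotProduct]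
        ring
    rw [h, mem_ball_zero_iff, pi_norm_lt_iff (by norm_num)]
    intro i
    fin_cases i
    · simp only [Fin.zero_eta, Matrix.cons_val_zero, Real.norm_eq_abs]
      rw [abs_of_pos] <;> norm_num
    · simp

theorem IsHaarProbability.isLocallyFiniteMeasure_primitiveMeasure (hμ : IsHaarProbability μ) :
    IsLocallyFiniteMeasure (primitiveMeasure μ) := by
  refine ⟨fun v => ?_⟩
  obtain ⟨M, hM⟩ := exists_vecMul_mem_ball v
  have hc : Continuous fun v : ℝ² => Matrix.vecMul v M.1 :=
    continuous_id.matrix_vecMul continuous_const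
  refine ⟨_, (Metric.isOpen_ball.preimage hc).mem_nhds hM, ?_⟩
  rw [← Measure.map_apply hc.measurable measurableSet_ball, hμ.map_primitiveMeasure]
  exact hμ.primitiveMeasure_ball_le.trans_lt (by simp)

/-- The mean value formula for nonzero lattice vectors, up to the value of the constant. -/
theorem IsHaarProbability.exists_lintegral_tsum_lattice (hμ : IsHaarProbability μ) :
    ∃ C : ℝ≥0∞, C ≠ ∞ ∧ ∀ f : ℝ² → ℝ≥0∞, Measurable f → f 0 = 0 →
      ∫⁻ x, ∑' m : Fin 2 → ℤ, f (Matrix.vecMul (intVec m) (rep x).lin.1) ∂μ = C * ∫⁻ v, f v := by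
  have := hμ.isLocallyFiniteMeasure_primitiveMeasure
  obtain ⟨c, hc⟩ := eq_smul_volume_of_map_vecMul_eq primitiveMeasure_zero hμ.map_primitiveMeasure
  refine ⟨∑' d : ℕ, c * ENNReal.ofReal ((d : ℝ) ^ 2)⁻¹, ?_, fun f hf hf0 => ?_⟩
  · rw [ENNReal.tsum_mul_left]
    refine ENNReal.mul_ne_top ENNReal.coe_ne_top ?_
    exact (Real.summable_nat_pow_inv.2 one_lt_two).tsum_ofReal_ne_top
  · have h1 (x : AffineLatticeSpace) :
        ∑' m : Fin 2 → ℤ, f (Matrix.vecMul (intVec m) (rep x).lin.1) =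
          ∑' d : ℕ, ∑' k : gammaSet 1 1 0,
            f ((d : ℝ) • Matrix.vecMul (intVec k) (rep x).lin.1) := by
      rw [tsum_eq_tsum_tsum_primitive]
      · simp only [intVec_smul, Matrix.smul_vecMul]
      · have : intVec 0 = 0 := by ext; simp [intVec]
        rw [this, Matrix.zero_vecMul, hf0]
    have hfd (d : ℕ) : Measurable fun v : ℝ² => f ((d : ℝ) • v) :=
      hf.comp (measurable_const_smul _)
    simp only [h1]
    rw [lintegral_tsum fun d => (measurable_comp_rep (measurable_tsum_primitive (hfd d))
      (isLeftInvariant_tsum_primitive fun v => f ((d : ℝ) • v))).aemeasurable,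
      ← ENNReal.tsum_mul_right]
    refine tsum_congr fun d => ?_
    rw [← lintegral_primitiveMeasure (hfd d), hc, lintegral_smul_measure]
    rcases Nat.eq_zero_or_pos d with rfl | hd
    · simp [hf0]
    · have hd' : (d : ℝ) ≠ 0 := by exact_mod_cast hd.ne'
      rw [← lintegral_map hf (measurable_const_smul _), Measure.map_addHaar_smul _ hd',
        lintegral_smul_measure, abs_of_nonneg (by positivity)]
      simp only [Module.finrank_fin_fun, smul_eq_mul, ENNReal.smul_def]
      ring

end AffineLatticeSpace

end LatticeVectors

/-! ### The value of the constant -/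

section Counting

open scoped MatrixGroups ENNReal NNReal Pointwise Topology
open Filter

local notation "ℝ²" => (Fin 2 → ℝ)

open ASL2

/-- The number of points of the lattice `ℤ² M` in a set. -/
noncomputable def latticeCount (M : SL(2, ℝ)) (s : Set ℝ²) : ℝ≥0∞ :=
  ∑' m : Fin 2 → ℤ, s.indicator 1 (Matrix.vecMul (intVec m) M.1)

theorem latticeCount_eq_encard (M : SL(2, ℝ)) (s : Set ℝ²) :
    latticeCount M s = {m : Fin 2 → ℤ | Matrix.vecMul (intVec m) M.1 ∈ s}.encard := by
  rw [← ENNReal.tsum_set_one]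
  exact (tsum_subtype {m : Fin 2 → ℤ | Matrix.vecMul (intVec m) M.1 ∈ s} 1).symm

/-- The half-open square of side `r`. -/
def squareIco (r : ℝ) : Set ℝ² := Set.univ.pi fun _ => Set.Ico 0 r

theorem mem_squareIco {r : ℝ} {v : ℝ²} : v ∈ squareIco r ↔ ∀ i, 0 ≤ v i ∧ v i < r := by
  simp [squareIco]

theorem measurableSet_squareIco (r : ℝ) : MeasurableSet (squareIco r) :=
  MeasurableSet.univ_pi fun _ => measurableSet_Ico

theorem volume_squareIco (n : ℕ) : volume (squareIco n) = (n : ℝ≥0∞) ^ 2 := by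
  simp [squareIco, Real.volume_pi_Ico]

/-- A square of side `n` contains at most `n²` times as many lattice points as the unit ball
about the origin, because differences of lattice points in a translate of the unit square are
lattice points in the ball. -/
theorem latticeCount_squareIco_le (M : SL(2, ℝ)) (n : ℕ) :
    latticeCount M (squareIco n) ≤ (n : ℝ≥0∞) ^ 2 * latticeCount M (Metric.ball 0 1) := by
  set N := latticeCount M (Metric.ball 0 1) with hN
  have hsub (c : ℝ²) : latticeCount M {v | v - c ∈ squareIco 1} ≤ N := by
    by_cases h : ∃ m₀ : Fin 2 → ℤ, Matrix.vecMul (intVec m₀) M.1 ∈ {v | v - c ∈ squareIco 1}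
    · obtain ⟨m₀, h₀⟩ := h
      calc latticeCount M {v | v - c ∈ squareIco 1}
          = ∑' m : Fin 2 → ℤ, {v | v - c ∈ squareIco 1}.indicator 1
              (Matrix.vecMul (intVec (m + m₀)) M.1) :=
            ((Equiv.addRight m₀).tsum_eq fun m : Fin 2 → ℤ =>
              {v | v - c ∈ squareIco 1}.indicator (1 : ℝ² → ℝ≥0∞)
                (Matrix.vecMul (intVec m) M.1)).symm
        _ ≤ N := by
            refine ENNReal.tsum_le_tsum fun m => ?_
            by_cases hm : Matrix.vecMul (intVec (m + m₀)) M.1 ∈ {v | v - c ∈ squareIco 1}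
            swap
            · rw [Set.indicator_of_notMem hm]
              exact zero_le
            suffices h : Matrix.vecMul (intVec m) M.1 ∈ Metric.ball (0 : ℝ²) 1 by
              rw [Set.indicator_of_mem hm, Set.indicator_of_mem h]
              exact le_rfl
            rw [intVec_add, Matrix.add_vecMul] at hm
            rw [Set.mem_ofPred_eq, mem_squareIco] at hm h₀
            rw [mem_ball_zero_iff, pi_norm_lt_iff one_pos]
            intro i
            have h1 := hm i
            have h2 := h₀ i
            simp only [Pi.sub_apply, Pi.add_apply] at h1 h2
            rw [Real.norm_eq_abs, abs_lt]
            constructor <;> linarith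
    · push Not at h
      refine le_of_eq_of_le (ENNReal.tsum_eq_zero.2 fun m => ?_) zero_le
      exact Set.indicator_of_notMem (h m) _
  set c : Fin n × Fin n → ℝ² := fun p => ![p.1, p.2] with hc
  calc latticeCount M (squareIco n)
      ≤ ∑' m : Fin 2 → ℤ, ∑ p : Fin n × Fin n, {v | v - c p ∈ squareIco 1}.indicator 1
          (Matrix.vecMul (intVec m) M.1) := by
        refine ENNReal.tsum_le_tsum fun m => ?_
        set v := Matrix.vecMul (intVec m) M.1 with hv
        by_cases hvn : v ∈ squareIco n
        · rw [Set.indicator_of_mem hvn]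
          rw [mem_squareIco] at hvn
          have hfl (i : Fin 2) : ⌊v i⌋₊ < n := (Nat.floor_lt (hvn i).1).2 (hvn i).2
          refine le_trans (le_of_eq ?_) (Finset.single_le_sum (fun _ _ => zero_le)
            (Finset.mem_univ ((⟨⌊v 0⌋₊, hfl 0⟩, ⟨⌊v 1⌋₊, hfl 1⟩) : Fin n × Fin n)))
          rw [Set.indicator_of_mem]
          rw [Set.mem_ofPred_eq, mem_squareIco]
          have hb (i : Fin 2) : 0 ≤ v i - ⌊v i⌋₊ ∧ v i - ⌊v i⌋₊ < 1 :=
            ⟨sub_nonneg.2 (Nat.floor_le (hvn i).1), by linarith [Nat.lt_floor_add_one (v i)]⟩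
          intro i
          fin_cases i
          · exact hb 0
          · exact hb 1
        · rw [Set.indicator_of_notMem hvn]
          exact zero_le
    _ = ∑ p : Fin n × Fin n, latticeCount M {v | v - c p ∈ squareIco 1} :=
        Summable.tsum_finsetSum fun _ _ => ENNReal.summable
    _ ≤ ∑ _p : Fin n × Fin n, N := Finset.sum_le_sum fun p _ => hsub _
    _ = (n : ℝ≥0∞) ^ 2 * N := by simp [sq]

/-- The lattice `ℤ² M` has density one. -/
theorem tendsto_latticeCount (M : SL(2, ℝ)) (hM : latticeCount M (Metric.ball 0 1) ≠ ∞) :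
    Tendsto (fun n : ℕ => latticeCount M (squareIco n) / (n : ℝ≥0∞) ^ 2) atTop (𝓝 1) := by
  set s : Set ℝ² := {v | Matrix.vecMul v M.1 ∈ squareIco 1} with hs
  have hmeas : MeasurableSet s :=
    (measurePreserving_vecMul M).measurable (measurableSet_squareIco 1)
  have hvol : volume s = 1 := by
    have := (measurePreserving_vecMul M).measure_preimage
      (measurableSet_squareIco 1).nullMeasurableSet
    have h1 := volume_squareIco 1
    rw [Nat.cast_one, Nat.cast_one, one_pow] at h1
    rwa [h1] at this
  have hconv : Convex ℝ s :=
    (convex_pi fun _ _ => convex_Ico 0 1).linear_preimage (Matrix.vecMulLinear M.1)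
  have hbdd : Bornology.IsBounded s := by
    obtain ⟨K, -, hK⟩ := norm_vecMul_le (M⁻¹).1
    refine isBounded_iff_forall_norm_le.2 ⟨K * 1, fun v hv => ?_⟩
    have h1 := hK (Matrix.vecMul v M.1)
    rw [vecMul_vecMul_inv] at h1
    have hv' := mem_squareIco.1 hv
    have hK0 : 0 ≤ K := by
      have := (norm_nonneg _).trans (hK (fun _ => 1))
      simpa using this
    refine h1.trans (mul_le_mul_of_nonneg_left ?_ hK0)
    refine (pi_norm_le_iff_of_nonneg zero_le_one).2 fun i => ?_
    rw [Real.norm_eq_abs, abs_of_nonneg (hv' i).1]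
    exact (hv' i).2.le
  have key := tendsto_card_div_pow_atTop_volume s hbdd hmeas (hconv.addHaar_frontier volume)
  rw [measureReal_def, hvol, ENNReal.toReal_one] at key
  have key2 := (ENNReal.continuous_ofReal.tendsto 1).comp key
  rw [ENNReal.ofReal_one] at key2
  refine key2.congr' ?_
  filter_upwards [eventually_ge_atTop 1] with n hn
  have hn0 : (n : ℝ) ≠ 0 := by positivity
  have : NeZero n := ⟨by omega⟩
  set T : Set (Fin 2 → ℤ) := {m | Matrix.vecMul (intVec m) M.1 ∈ squareIco n} with hT
  have hTfin : T.Finite := by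
    rw [← Set.encard_ne_top_iff]
    intro h
    have h1 := latticeCount_squareIco_le M n
    rw [latticeCount_eq_encard, ← hT, h, ENat.toENNReal_top, top_le_iff] at h1
    exact ENNReal.mul_ne_top (by simp) hM h1
  have hcard : Nat.card ↑(s ∩ (n : ℝ)⁻¹ •
      (Submodule.span ℤ (Set.range (Pi.basisFun ℝ (Fin 2))) : Set ℝ²)) = T.ncard := by
    rw [← Nat.card_coe_set_eq]
    have hmem (m : T) : (n : ℝ)⁻¹ • intVec m.1 ∈ s ∩ (n : ℝ)⁻¹ •
        (Submodule.span ℤ (Set.range (Pi.basisFun ℝ (Fin 2))) : Set ℝ²) := by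
      constructor
      · have h1 := mem_squareIco.1 m.2
        rw [hs, Set.mem_ofPred_eq, mem_squareIco, Matrix.smul_vecMul]
        intro i
        rw [Pi.smul_apply, smul_eq_mul, inv_mul_lt_iff₀ (by positivity), mul_one]
        exact ⟨mul_nonneg (by positivity) (h1 i).1, (h1 i).2⟩
      · refine BoxIntegral.unitPartition.mem_smul_span_iff.2 fun i => ⟨m.1 i, ?_⟩
        simp [intVec, hn0]
    refine (Nat.card_congr (Equiv.ofBijective (fun m : T => ⟨_, hmem m⟩) ⟨?_, ?_⟩)).symm
    · intro a b hab
      have h1 := congrArg Subtype.val hab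
      have h2 := smul_right_injective _ (inv_ne_zero hn0) h1
      refine Subtype.ext (funext fun i => ?_)
      have := congrFun h2 i
      simpa [intVec] using this
    · rintro ⟨v, hv, hv'⟩
      choose m hm using BoxIntegral.unitPartition.mem_smul_span_iff.1 hv'
      have hmv : intVec m = (n : ℝ) • v := funext fun i => hm i
      refine ⟨⟨m, ?_⟩, Subtype.ext ?_⟩
      · have h1 := mem_squareIco.1 hv
        rw [hT, Set.mem_ofPred_eq, mem_squareIco, hmv, Matrix.smul_vecMul]
        intro i
        rw [Pi.smul_apply, smul_eq_mul]
        have hnp : (0 : ℝ) < n := by positivity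
        exact ⟨mul_nonneg hnp.le (h1 i).1, by nlinarith [(h1 i).2]⟩
      · simp only [hmv, smul_smul, inv_mul_cancel₀ hn0, one_smul]
  rw [latticeCount_eq_encard, ← hT, ← hTfin.cast_ncard_eq]
  simp only [Function.comp_apply, hcard, Fintype.card_fin]
  rw [ENNReal.ofReal_div_of_pos (by positivity), ENNReal.ofReal_pow (by positivity)]
  simp

namespace AffineLatticeSpace

variable {μ : Measure AffineLatticeSpace}

theorem measurable_latticeCount_rep {s : Set ℝ²} (hs : MeasurableSet s) :
    Measurable fun x => latticeCount (rep x).lin s :=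
  measurable_comp_rep (measurable_tsum_lattice (measurable_one.indicator hs))
    (isLeftInvariant_tsum_lattice _)

theorem latticeCount_eq_one_add (M : SL(2, ℝ)) {s : Set ℝ²} (h0 : 0 ∈ s) :
    latticeCount M s = 1 + latticeCount M (s \ {0}) := by
  have hz : intVec 0 = 0 := by ext; simp [intVec]
  have h1 : (1 : ℝ≥0∞) = latticeCount M {0} := by
    rw [latticeCount, tsum_eq_single 0]
    · simp [hz]
    · exact fun m hm => Set.indicator_of_notMem
        (by simpa using vecMul_intVec_ne_zero M hm) _
  rw [h1, latticeCount, latticeCount, latticeCount, ← ENNReal.tsum_add]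
  refine tsum_congr fun m => ?_
  have h2 := congrFun (Set.indicator_union_of_disjoint
    (Set.disjoint_sdiff_right (s := ({0} : Set ℝ²)) (t := s)) (1 : ℝ² → ℝ≥0∞))
    (Matrix.vecMul (intVec m) M.1)
  rwa [Set.union_sdiff_cancel (Set.singleton_subset_iff.2 h0)] at h2

/-- **Siegel's mean value theorem** in dimension two. -/
theorem IsHaarProbability.lintegral_tsum_lattice (hμ : IsHaarProbability μ) {f : ℝ² → ℝ≥0∞}
    (hf : Measurable f) (hf0 : f 0 = 0) :
    ∫⁻ x, ∑' m : Fin 2 → ℤ, f (Matrix.vecMul (intVec m) (rep x).lin.1) ∂μ = ∫⁻ v, f v := by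
  have := hμ.isProbabilityMeasure
  obtain ⟨C, hC, h⟩ := hμ.exists_lintegral_tsum_lattice
  suffices hC1 : C = 1 by rw [h f hf hf0, hC1, one_mul]
  have hcount {s : Set ℝ²} (hs : MeasurableSet s) (h0 : 0 ∈ s) :
      ∫⁻ x, latticeCount (rep x).lin s ∂μ = 1 + C * volume s := by
    have h1 := h ((s \ {0}).indicator 1)
      (measurable_one.indicator (hs.diff (measurableSet_singleton 0)))
      (Set.indicator_of_notMem (by simp) _)
    rw [lintegral_indicator_one (hs.diff (measurableSet_singleton 0)),
      measure_sdiff_null (measure_singleton _)] at h1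
    simp only [latticeCount_eq_one_add _ h0]
    rw [lintegral_add_left measurable_const, lintegral_const, measure_univ, mul_one]
    exact congrArg _ h1
  have hball : ∫⁻ x, latticeCount (rep x).lin (Metric.ball 0 1) ∂μ ≠ ∞ := by
    rw [hcount measurableSet_ball (by simp)]
    exact ENNReal.add_ne_top.2 ⟨ENNReal.one_ne_top,
      ENNReal.mul_ne_top hC measure_ball_lt_top.ne⟩
  -- Both sides of the limit of `∫ N_n / n²`, where `N_n` counts the points in a square of side `n`.
  have hlim : Tendsto (fun n : ℕ => ∫⁻ x, latticeCount (rep x).lin (squareIco n) /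
      (n : ℝ≥0∞) ^ 2 ∂μ) atTop (𝓝 (∫⁻ _, 1 ∂μ)) := by
    refine tendsto_lintegral_of_dominated_convergence
      (fun x => latticeCount (rep x).lin (Metric.ball 0 1))
      (fun n => (measurable_latticeCount_rep (measurableSet_squareIco _)).div_const _)
      (fun n => Eventually.of_forall fun x => ?_) hball ?_
    · exact ENNReal.div_le_of_le_mul' (latticeCount_squareIco_le _ n)
    · filter_upwards [ae_lt_top (measurable_latticeCount_rep measurableSet_ball) hball] with x hx
      exact tendsto_latticeCount _ hx.ne
  have hlim' : Tendsto (fun n : ℕ => ∫⁻ x, latticeCount (rep x).lin (squareIco n) /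
      (n : ℝ≥0∞) ^ 2 ∂μ) atTop (𝓝 (0 + C)) := by
    have h2 : Tendsto (fun n : ℕ => ((n : ℝ≥0∞) ^ 2)⁻¹ + C) atTop (𝓝 (0 + C)) := by
      refine Tendsto.add ?_ tendsto_const_nhds
      have := ENNReal.Tendsto.pow (n := 2) ENNReal.tendsto_inv_nat_nhds_zero
      simpa [ENNReal.inv_pow] using this
    refine h2.congr' ?_
    filter_upwards [eventually_ge_atTop 1] with n hn
    have hn0 : (n : ℝ≥0∞) ^ 2 ≠ 0 := pow_ne_zero _ (by exact_mod_cast (by omega : n ≠ 0))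
    have hnt : (n : ℝ≥0∞) ^ 2 ≠ ∞ := by simp
    have h0 : (0 : ℝ²) ∈ squareIco n := mem_squareIco.2 fun i => ⟨le_rfl, by simp; omega⟩
    simp only [div_eq_mul_inv]
    rw [lintegral_mul_const _ (measurable_latticeCount_rep (measurableSet_squareIco _)),
      hcount (measurableSet_squareIco _) h0, volume_squareIco, add_mul, one_mul, mul_assoc,
      ENNReal.mul_inv_cancel hn0 hnt, mul_one]
  have := tendsto_nhds_unique hlim' hlim
  simpa using this

end AffineLatticeSpace

end Counting

/-! ### The mean value over pairs of distinct points -/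

section Pairs

open scoped MatrixGroups ENNReal

local notation "ℝ²" => (Fin 2 → ℝ)

open ASL2

namespace ASL2

theorem isLeftInvariant_tsum_pairTerm (F : ℝ² × ℝ² → ℝ≥0∞) :
    IsLeftInvariant fun g => ∑' p, pairTerm F g p := fun γ m g => by
  obtain ⟨e, he⟩ := exists_pairTerm_mul F g _ (ofInt_mem γ m)
  exact (tsum_congr he).trans (e.tsum_eq (pairTerm F g))

theorem measurable_pairTerm {β : Type*} [MeasurableSpace β] {F : ℝ² × ℝ² → β} (hF : Measurable F)
    (p : DistinctPairs) : Measurable fun g => pairTerm F g p :=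
  hF.comp ((measurable_act _).prodMk (measurable_act _))

theorem act_add (m k : Fin 2 → ℤ) (g : ASL2) :
    act (intVec (m + k)) g = act (intVec m) g + Matrix.vecMul (intVec k) g.lin.1 := by
  simp only [act, intVec_add, Matrix.add_vecMul]
  abel

/-- A pair of distinct points of the affine lattice is a point together with a nonzero vector of
the lattice. -/
theorem tsum_pairTerm_eq (F : ℝ² × ℝ² → ℝ≥0∞) (g : ASL2) :
    ∑' p, pairTerm F g p = ∑' m : Fin 2 → ℤ, ∑' k : Fin 2 → ℤ,
      ({0}ᶜ : Set ℝ²).indicator (fun v => F (act (intVec m) g, act (intVec m) g + v))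
        (Matrix.vecMul (intVec k) g.lin.1) := by
  let e : (Fin 2 → ℤ) × (Fin 2 → ℤ) ≃ (Fin 2 → ℤ) × (Fin 2 → ℤ) :=
    { toFun := fun p => (p.1, p.1 + p.2)
      invFun := fun p => (p.1, p.2 - p.1)
      left_inv := fun p => by simp
      right_inv := fun p => by simp }
  rw [← ENNReal.tsum_prod]
  refine (tsum_subtype {p : (Fin 2 → ℤ) × (Fin 2 → ℤ) | p.1 ≠ p.2}
    (fun p => F (act (intVec p.1) g, act (intVec p.2) g))).trans ?_
  rw [← e.tsum_eq]
  refine tsum_congr fun ⟨m, k⟩ => ?_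
  have hz : intVec 0 = 0 := by ext; simp [intVec]
  by_cases hk : k = 0
  · rw [Set.indicator_of_notMem (by simp [e, hk]), Set.indicator_of_notMem (by simp [hk, hz])]
  · rw [Set.indicator_of_mem (by simpa [e] using hk),
      Set.indicator_of_mem (by simpa using vecMul_intVec_ne_zero g.lin hk)]
    simp only [e, Equiv.coe_fn_mk, act_add]

end ASL2

namespace AffineLatticeSpace

variable {μ : Measure AffineLatticeSpace}

/-- The mean value formula for nonnegative functions. -/
theorem IsHaarProbability.lintegral_tsum_pairTerm (hμ : IsHaarProbability μ)
    {F : ℝ² × ℝ² → ℝ≥0∞} (hF : Measurable F) :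
    ∫⁻ x, ∑' p, pairTerm F (rep x) p ∂μ = ∫⁻ y, F y := by
  set f : ℝ² → ℝ² → ℝ≥0∞ := fun s v => ({0}ᶜ : Set ℝ²).indicator (fun v => F (s, s + v)) v with hf
  have hfm : Measurable (Function.uncurry f) := by
    have h1 : Function.uncurry f = (Prod.snd ⁻¹' ({0}ᶜ : Set ℝ²)).indicator
        fun p : ℝ² × ℝ² => F (p.1, p.1 + p.2) := by
      ext ⟨s, v⟩
      rfl
    rw [h1]
    exact Measurable.indicator (by fun_prop)
      (measurable_snd (measurableSet_singleton (0 : ℝ²)).compl)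
  have hf0 (s : ℝ²) : f s 0 = 0 := Set.indicator_of_notMem (by simp) _
  simp only [tsum_pairTerm_eq]
  have hH : Measurable fun p : ASL2 × ℝ² =>
      ∑' k : Fin 2 → ℤ, f p.2 (Matrix.vecMul (intVec k) p.1.lin.1) := by
    refine Measurable.tsum fun k => ?_
    have h := hfm.comp (measurable_snd.prodMk
      ((measurable_vecMul_lin_left (intVec k)).comp (measurable_fst (β := ℝ²))))
    exact h
  refine (hμ.lintegral_tsum_act
    (H := fun M s => ∑' k : Fin 2 → ℤ, f s (Matrix.vecMul (intVec k) M.1)) hH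
    fun γ M s => ?_).trans ?_
  · simp only [vecMul_map_mul]
    exact (vecMulEquiv γ).tsum_eq fun k => f s (Matrix.vecMul (intVec k) M.1)
  calc ∫⁻ x, (∫⁻ s, ∑' k : Fin 2 → ℤ, f s (Matrix.vecMul (intVec k) (rep x).lin.1)) ∂μ
      = ∫⁻ x, ∑' k : Fin 2 → ℤ, (∫⁻ s, f s (Matrix.vecMul (intVec k) (rep x).lin.1)) ∂μ :=
        lintegral_congr fun x => lintegral_tsum fun k =>
          (hfm.comp (measurable_prodMk_right (y := _))).aemeasurable
    _ = ∫⁻ v, ∫⁻ s, f s v :=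
        hμ.lintegral_tsum_lattice (f := fun v => ∫⁻ s, f s v) hfm.lintegral_prod_left'
          (by simp [hf0])
    _ = ∫⁻ s, ∫⁻ v, f s v := (lintegral_lintegral_swap hfm.aemeasurable).symm
    _ = ∫⁻ s, ∫⁻ v, F (s, s + v) := by
        refine lintegral_congr fun s => lintegral_congr_ae ?_
        filter_upwards [compl_mem_ae_iff.2 (measure_singleton (0 : ℝ²))] with v hv
        exact Set.indicator_of_mem hv _
    _ = ∫⁻ s, ∫⁻ u, F (s, u) :=
        lintegral_congr fun s => lintegral_add_left_eq_self (fun u => F (s, u)) s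
    _ = ∫⁻ y, F y := by
        rw [Measure.volume_eq_prod, lintegral_prod _ hF.aemeasurable]

end AffineLatticeSpace

end Pairs

/-! ### Integrable functions -/

section Integrable

open scoped MatrixGroups ENNReal

local notation "ℝ²" => (Fin 2 → ℝ)

open ASL2

namespace AffineLatticeSpace

variable {μ : Measure AffineLatticeSpace} {𝕜 : Type*} [RCLike 𝕜]

theorem pairSum_eq (F : ℝ² × ℝ² → 𝕜) (x : AffineLatticeSpace) :
    pairSum F x = ∑' p, pairTerm F (rep x) p := by
  conv_lhs => rw [← mk_rep x]
  rfl

theorem summable_pairTerm_of_rep {F : ℝ² × ℝ² → 𝕜} {x : AffineLatticeSpace}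
    (h : Summable fun p => pairTerm F (rep x) p) {g : ASL2} (hg : mk g = x) :
    Summable fun p => pairTerm F g p := by
  have h1 : g * (rep x)⁻¹ ∈ integerPoints := mk_eq_mk.1 (by rw [hg, mk_rep])
  obtain ⟨e, he⟩ := exists_pairTerm_mul F (rep x) _ h1
  rw [inv_mul_cancel_right] at he
  simp only [he]
  exact e.summable_iff.2 h

/-- A null set of `ℝ⁴` is avoided by all pairs of distinct points of almost every affine
lattice. -/
theorem IsHaarProbability.ae_forall_pairTerm (hμ : IsHaarProbability μ) {P : ℝ² × ℝ² → Prop}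
    (hP : ∀ᵐ y, P y) : ∀ᵐ x ∂μ, ∀ p, P (pairTerm id (rep x) p) := by
  set N := toMeasurable volume {y | ¬ P y} with hN
  have hNm : MeasurableSet N := measurableSet_toMeasurable _ _
  have hN0 : volume N = 0 := by rw [hN, measure_toMeasurable]; exact hP
  have hm : Measurable (N.indicator (1 : ℝ² × ℝ² → ℝ≥0∞)) := measurable_one.indicator hNm
  have h := hμ.lintegral_tsum_pairTerm hm
  rw [lintegral_indicator_one hNm, hN0, lintegral_eq_zero_iff (measurable_comp_rep
    (Measurable.tsum fun p => measurable_pairTerm hm p) (isLeftInvariant_tsum_pairTerm _))] at h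
  filter_upwards [h] with x hx p
  by_contra hp
  have h1 := ENNReal.tsum_eq_zero.1 hx p
  have h2 : pairTerm id (rep x) p ∈ N := subset_toMeasurable _ _ hp
  have h3 : N.indicator (1 : ℝ² × ℝ² → ℝ≥0∞) (pairTerm id (rep x) p) = 0 := h1
  rw [Set.indicator_of_mem h2] at h3
  exact one_ne_zero h3

theorem IsHaarProbability.ae_summable_pairTerm (hμ : IsHaarProbability μ) {F : ℝ² × ℝ² → 𝕜}
    (hFm : Measurable F) (hF : Integrable F) :
    ∀ᵐ x ∂μ, Summable fun p => pairTerm F (rep x) p := by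
  have hm : Measurable fun y => ‖F y‖ₑ := hFm.enorm
  have h := hμ.lintegral_tsum_pairTerm hm
  filter_upwards [ae_lt_top (measurable_comp_rep (Measurable.tsum fun p => measurable_pairTerm hm p)
    (isLeftInvariant_tsum_pairTerm _)) (h.trans_ne hF.2.ne)] with x hx
  refine Summable.of_norm ?_
  have h1 : (fun p => ‖pairTerm F (rep x) p‖) =
      fun p => (pairTerm (fun y => ‖F y‖ₑ) (rep x) p).toReal := by
    funext p
    simp [pairTerm]
  rw [h1]
  exact ENNReal.summable_toReal hx.ne

theorem tsum_eq_toReal_sub_toReal {ι : Type*} {a : ι → ℝ} (ha : Summable a) :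
    ∑' i, a i = (∑' i, ENNReal.ofReal (a i)).toReal - (∑' i, ENNReal.ofReal (-a i)).toReal := by
  have h1 : Summable fun i => max (a i) 0 :=
    ha.abs.of_nonneg_of_le (fun i => le_max_right _ _)
      fun i => max_le (le_abs_self _) (abs_nonneg _)
  have h2 : Summable fun i => max (-a i) 0 :=
    ha.abs.of_nonneg_of_le (fun i => le_max_right _ _)
      fun i => max_le (neg_le_abs _) (abs_nonneg _)
  rw [ENNReal.tsum_toReal_eq fun i => ENNReal.ofReal_ne_top,
    ENNReal.tsum_toReal_eq fun i => ENNReal.ofReal_ne_top]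
  simp only [ENNReal.toReal_ofReal']
  rw [← h1.tsum_sub h2]
  exact tsum_congr fun i => (max_zero_sub_max_neg_zero_eq_self _).symm

theorem IsHaarProbability.integral_pairSum_real (hμ : IsHaarProbability μ) {f : ℝ² × ℝ² → ℝ}
    (hfm : Measurable f) (hf : Integrable f) :
    Integrable (pairSum f) μ ∧ ∫ x, pairSum f x ∂μ = ∫ y, f y := by
  set S : (ℝ² × ℝ² → ℝ) → AffineLatticeSpace → ℝ≥0∞ :=
    fun f x => ∑' p, pairTerm (fun y => ENNReal.ofReal (f y)) (rep x) p with hS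
  have hSm {f : ℝ² × ℝ² → ℝ} (hfm : Measurable f) : Measurable (S f) :=
    measurable_comp_rep (Measurable.tsum fun p => measurable_pairTerm hfm.ennreal_ofReal p)
      (isLeftInvariant_tsum_pairTerm _)
  have hSi {f : ℝ² × ℝ² → ℝ} (hfm : Measurable f) :
      ∫⁻ x, S f x ∂μ = ∫⁻ y, ENNReal.ofReal (f y) :=
    hμ.lintegral_tsum_pairTerm hfm.ennreal_ofReal
  have hSfin {f : ℝ² × ℝ² → ℝ} (hfm : Measurable f) (hf : Integrable f) :
      ∫⁻ x, S f x ∂μ ≠ ∞ := by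
    rw [hSi hfm]
    exact hf.lintegral_lt_top.ne
  have hae : pairSum f =ᵐ[μ] fun x => (S f x).toReal - (S (fun y => -f y) x).toReal := by
    filter_upwards [hμ.ae_summable_pairTerm hfm hf] with x hx
    rw [pairSum_eq, tsum_eq_toReal_sub_toReal hx]
    rfl
  have hneg : Measurable fun y => -f y := hfm.neg
  have hnegi : Integrable fun y => -f y := hf.neg
  have h1 : Integrable (fun x => (S f x).toReal) μ :=
    integrable_toReal_of_lintegral_ne_top (hSm hfm).aemeasurable (hSfin hfm hf)
  have h2 : Integrable (fun x => (S (fun y => -f y) x).toReal) μ :=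
    integrable_toReal_of_lintegral_ne_top (hSm hneg).aemeasurable (hSfin hneg hnegi)
  refine ⟨(h1.sub h2).congr hae.symm, ?_⟩
  rw [integral_congr_ae hae, integral_sub h1 h2,
    integral_toReal (hSm hfm).aemeasurable (ae_lt_top (hSm hfm) (hSfin hfm hf)),
    integral_toReal (hSm hneg).aemeasurable (ae_lt_top (hSm hneg) (hSfin hneg hnegi)),
    hSi hfm, hSi hneg, integral_eq_lintegral_pos_part_sub_lintegral_neg_part hf]

theorem IsHaarProbability.integral_pairSum_of_measurable (hμ : IsHaarProbability μ)
    {F : ℝ² × ℝ² → 𝕜} (hFm : Measurable F) (hF : Integrable F) :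
    Integrable (pairSum F) μ ∧ ∫ x, pairSum F x ∂μ = ∫ y, F y := by
  obtain ⟨hr1, hr2⟩ := hμ.integral_pairSum_real (f := fun y => RCLike.re (F y)) (by fun_prop) hF.re
  obtain ⟨hi1, hi2⟩ := hμ.integral_pairSum_real (f := fun y => RCLike.im (F y)) (by fun_prop) hF.im
  have hae : pairSum F =ᵐ[μ] fun x => ((pairSum (fun y => RCLike.re (F y)) x : ℝ) : 𝕜) +
      (pairSum (fun y => RCLike.im (F y)) x : ℝ) * RCLike.I := by
    filter_upwards [hμ.ae_summable_pairTerm hFm hF] with x hx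
    rw [pairSum_eq, pairSum_eq, pairSum_eq, ← RCLike.re_add_im (∑' p, pairTerm F (rep x) p)]
    rw [← RCLike.reCLM_apply, ← RCLike.imCLM_apply, RCLike.reCLM.map_tsum hx,
      RCLike.imCLM.map_tsum hx]
    rfl
  have h1 : Integrable (fun x => ((pairSum (fun y => RCLike.re (F y)) x : ℝ) : 𝕜)) μ := hr1.ofReal
  have h2 : Integrable (fun x => ((pairSum (fun y => RCLike.im (F y)) x : ℝ) : 𝕜) * RCLike.I) μ :=
    hi1.ofReal.mul_const _
  refine ⟨(h1.add h2).congr hae.symm, ?_⟩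
  rw [integral_congr_ae hae, integral_add h1 h2, integral_mul_const, integral_ofReal,
    integral_ofReal, hr2, hi2]
  exact integral_re_add_im hF

/-- The mean value formula, with absolute convergence of the series. -/
theorem IsHaarProbability.integral_pairSum (hμ : IsHaarProbability μ) {F : ℝ² × ℝ² → 𝕜}
    (hF : Integrable F) :
    (∀ᵐ x ∂μ, ∀ g : ASL2, AffineLatticeSpace.mk g = x → Summable fun p => pairTerm F g p) ∧
      Integrable (pairSum F) μ ∧ ∫ x, pairSum F x ∂μ = ∫ y, F y := by
  set G := hF.1.mk F with hG
  have hGm : Measurable G := hF.1.stronglyMeasurable_mk.measurable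
  have hFG : F =ᵐ[volume] G := hF.1.ae_eq_mk
  have hGi : Integrable G := hF.congr hFG
  have hterm : ∀ᵐ x ∂μ, ∀ p, pairTerm F (rep x) p = pairTerm G (rep x) p :=
    hμ.ae_forall_pairTerm hFG
  have hsum : pairSum F =ᵐ[μ] pairSum G := by
    filter_upwards [hterm] with x hx
    rw [pairSum_eq, pairSum_eq]
    exact tsum_congr hx
  obtain ⟨h1, h2⟩ := hμ.integral_pairSum_of_measurable hGm hGi
  refine ⟨?_, h1.congr hsum.symm, ?_⟩
  · filter_upwards [hterm, hμ.ae_summable_pairTerm hGm hGi] with x hx hs g hg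
    exact summable_pairTerm_of_rep ((summable_congr hx).2 hs) hg
  · rw [integral_congr_ae hsum, h2, integral_congr_ae hFG]

end AffineLatticeSpace

end Integrable

/-! ### Haar measure on the group -/

section HaarMeasure

open scoped MatrixGroups ENNReal

local notation "ℝ²" => (Fin 2 → ℝ)

/-- The type of real two-by-two matrices, as a type of functions with its Lebesgue measure. -/
local notation "ℝ⁴" => (Fin 2 → Fin 2 → ℝ)

namespace ASL2

/-- Right multiplication of matrices by `M`. -/
def matrixMulRight (M : SL(2, ℝ)) (A : ℝ⁴) : ℝ⁴ := fun i => Matrix.vecMul (A i) M.1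

/-- Left multiplication of matrices by `M`. -/
def matrixMulLeft (M : SL(2, ℝ)) (A : ℝ⁴) : ℝ⁴ := fun i j => ∑ k, M.1 i k * A k j

theorem of_matrixMulRight (M : SL(2, ℝ)) (A : ℝ⁴) :
    Matrix.of (matrixMulRight M A) = Matrix.of A * M.1 := rfl

theorem of_matrixMulLeft (M : SL(2, ℝ)) (A : ℝ⁴) :
    Matrix.of (matrixMulLeft M A) = M.1 * Matrix.of A := rfl

theorem det_matrixMulRight (M : SL(2, ℝ)) (A : ℝ⁴) :
    (Matrix.of (matrixMulRight M A)).det = (Matrix.of A).det := by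
  rw [of_matrixMulRight, Matrix.det_mul, M.2, mul_one]

theorem det_matrixMulLeft (M : SL(2, ℝ)) (A : ℝ⁴) :
    (Matrix.of (matrixMulLeft M A)).det = (Matrix.of A).det := by
  rw [of_matrixMulLeft, Matrix.det_mul, M.2, one_mul]

theorem measurePreserving_matrixMulRight (M : SL(2, ℝ)) :
    MeasurePreserving (matrixMulRight M) volume volume := by
  have h := volume_preserving_pi (ι := Fin 2) (α' := fun _ => ℝ²) (β' := fun _ => ℝ²)
    (f := fun _ v => Matrix.vecMul v M.1) fun _ => measurePreserving_vecMul M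
  exact h

theorem measurePreserving_transpose :
    MeasurePreserving (fun A : ℝ⁴ => fun i j => A j i) volume volume := by
  let f : ℝ⁴ →ₗ[ℝ] ℝ⁴ :=
    { toFun := fun A i j => A j i, map_add' := fun _ _ => rfl, map_smul' := fun _ _ => rfl }
  have hff : f ∘ₗ f = LinearMap.id := rfl
  have hdet : LinearMap.det f * LinearMap.det f = 1 := by
    rw [← LinearMap.det_comp, hff, LinearMap.det_id]
  have h0 : LinearMap.det f ≠ 0 := fun h => by simp [h] at hdet
  have habs : |(LinearMap.det f)⁻¹| = 1 := by
    rcases mul_self_eq_one_iff.1 hdet with h | h <;> simp [h]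
  have h := Measure.map_linearMap_addHaar_eq_smul_addHaar volume h0
  rw [habs, ENNReal.ofReal_one, one_smul] at h
  exact ⟨f.continuous_of_finiteDimensional.measurable, h⟩

theorem measurePreserving_matrixMulLeft (M : SL(2, ℝ)) :
    MeasurePreserving (matrixMulLeft M) volume volume := by
  have h := measurePreserving_transpose.comp
    ((measurePreserving_matrixMulRight M.transpose).comp measurePreserving_transpose)
  convert h using 1
  funext A i j
  simp [matrixMulLeft, matrixMulRight, Matrix.vecMul, dotProduct, mul_comm]

/-- Matrices with determinant strictly between zero and one: an open cone over `SL(2, ℝ)`. -/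
def detCone : Set ℝ⁴ := {A | 0 < (Matrix.of A).det ∧ (Matrix.of A).det < 1}

theorem isOpen_detCone : IsOpen detCone := by
  have h : Continuous fun A : ℝ⁴ => (Matrix.of A).det := Continuous.matrix_det continuous_id
  exact (isOpen_lt continuous_const h).inter (isOpen_lt h continuous_const)

/-- The projection of the cone to `SL(2, ℝ)`: division by the square root of the determinant.
The value outside the cone is irrelevant. -/
noncomputable def normalize (A : ℝ⁴) : SL(2, ℝ) :=
  if h : 0 < (Matrix.of A).det then
    ⟨(√(Matrix.of A).det)⁻¹ • Matrix.of A, by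
      rw [Matrix.det_smul, Fintype.card_fin, inv_pow, Real.sq_sqrt h.le, inv_mul_cancel₀ h.ne']⟩
  else 1

theorem normalize_apply {A : ℝ⁴} (h : 0 < (Matrix.of A).det) (i j : Fin 2) :
    (normalize A).1 i j = (√(Matrix.of A).det)⁻¹ * A i j := by
  simp [normalize, h]

theorem measurable_normalize (i j : Fin 2) : Measurable fun A : ℝ⁴ => (normalize A).1 i j := by
  have hc : Continuous fun A : ℝ⁴ => (Matrix.of A).det := Continuous.matrix_det continuous_id
  have hd := hc.measurable
  have : (fun A : ℝ⁴ => (normalize A).1 i j) = fun A =>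
      if 0 < (Matrix.of A).det then (√(Matrix.of A).det)⁻¹ * A i j
      else (1 : Matrix (Fin 2) (Fin 2) ℝ) i j := by
    funext A
    by_cases h : 0 < (Matrix.of A).det
    · rw [normalize_apply h, if_pos h]
    · simp [normalize, h]
  rw [this]
  exact Measurable.ite (measurableSet_lt measurable_const hd)
    (hd.sqrt.inv.mul ((measurable_pi_apply j).comp (measurable_pi_apply i))) measurable_const

theorem normalize_matrixMulRight {A : ℝ⁴} (h : A ∈ detCone) (M : SL(2, ℝ)) :
    normalize (matrixMulRight M A) = normalize A * M := by
  ext i j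
  have h1 := normalize_apply (A := matrixMulRight M A) ((det_matrixMulRight M A).symm ▸ h.1) i j
  rw [det_matrixMulRight] at h1
  refine h1.trans ?_
  rw [Matrix.SpecialLinearGroup.coe_mul, Matrix.mul_apply]
  simp only [matrixMulRight, Matrix.vecMul, dotProduct, normalize_apply h.1, Finset.mul_sum,
    mul_assoc]

theorem normalize_matrixMulLeft {A : ℝ⁴} (h : A ∈ detCone) (M : SL(2, ℝ)) :
    normalize (matrixMulLeft M A) = M * normalize A := by
  ext i j
  have h1 := normalize_apply (A := matrixMulLeft M A) ((det_matrixMulLeft M A).symm ▸ h.1) i j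
  rw [det_matrixMulLeft] at h1
  refine h1.trans ?_
  rw [Matrix.SpecialLinearGroup.coe_mul, Matrix.mul_apply]
  simp only [matrixMulLeft, normalize_apply h.1, Finset.mul_sum, mul_left_comm]

/-- The Haar measure of `G'`: the image of Lebesgue measure on the product of the cone over
`SL(2, ℝ)` with the plane. Lebesgue measure on matrices is invariant under multiplication by
matrices of determinant one, from either side. -/
noncomputable def haar : Measure ASL2 :=
  ((volume.restrict detCone).prod volume).map fun p : ℝ⁴ × ℝ² => ⟨normalize p.1, p.2⟩

theorem measurable_coneMap : Measurable fun p : ℝ⁴ × ℝ² => (⟨normalize p.1, p.2⟩ : ASL2) :=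
  ASL2.measurable_mk (fun i j => (measurable_normalize i j).comp measurable_fst) measurable_snd

theorem lintegral_haar {f : ASL2 → ℝ≥0∞} (hf : Measurable f) :
    ∫⁻ g, f g ∂haar = ∫⁻ A in detCone, ∫⁻ ξ : ℝ², f ⟨normalize A, ξ⟩ := by
  rw [haar, lintegral_map hf measurable_coneMap,
    lintegral_prod (fun p : ℝ⁴ × ℝ² => f ⟨normalize p.1, p.2⟩)
      (hf.comp measurable_coneMap).aemeasurable]

theorem measurable_lintegral_normalize {f : ASL2 → ℝ≥0∞} (hf : Measurable f) :
    Measurable fun A : ℝ⁴ => ∫⁻ ξ : ℝ², f ⟨normalize A, ξ⟩ :=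
  (hf.comp measurable_coneMap).lintegral_prod_right'

theorem setLIntegral_detCone_comp {T : ℝ⁴ → ℝ⁴} (hT : MeasurePreserving T volume volume)
    (hTd : ∀ A, (Matrix.of (T A)).det = (Matrix.of A).det) {f : ℝ⁴ → ℝ≥0∞} (hf : Measurable f) :
    ∫⁻ A in detCone, f (T A) = ∫⁻ A in detCone, f A := by
  have h1 : T ⁻¹' detCone = detCone := by
    ext A
    simp only [detCone, Set.mem_preimage, Set.mem_ofPred_eq, hTd]
  have h := hT.restrict_preimage isOpen_detCone.measurableSet
  rw [h1] at h
  exact h.lintegral_comp hf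

theorem measurable_section {f : ASL2 → ℝ≥0∞} (hf : Measurable f) (M : SL(2, ℝ)) :
    Measurable fun ξ : ℝ² => f ⟨M, ξ⟩ :=
  hf.comp (ASL2.measurable_mk (fun _ _ => measurable_const) measurable_id)

theorem lintegral_haar_mul_right {f : ASL2 → ℝ≥0∞} (hf : Measurable f) (h : ASL2) :
    ∫⁻ g, f (g * h) ∂haar = ∫⁻ g, f g ∂haar := by
  rw [lintegral_haar (f := fun g => f (g * h))
    (hf.comp (ASL2.continuous_mul_right h).measurable), lintegral_haar hf,
    ← setLIntegral_detCone_comp (measurePreserving_matrixMulRight h.lin)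
      (det_matrixMulRight h.lin) (measurable_lintegral_normalize hf)]
  refine setLIntegral_congr_fun isOpen_detCone.measurableSet fun A hA => ?_
  simp only [normalize_matrixMulRight hA]
  have hm := measurable_section hf (normalize A * h.lin)
  rw [← lintegral_add_right_eq_self (fun ξ => f ⟨normalize A * h.lin, ξ⟩) h.shift,
    ← lintegral_vecMul h.lin (f := fun ξ => f ⟨normalize A * h.lin, ξ + h.shift⟩)
      (hm.comp (measurable_id.add_const h.shift))]
  rfl

theorem lintegral_haar_mul_left {f : ASL2 → ℝ≥0∞} (hf : Measurable f) (h : ASL2) :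
    ∫⁻ g, f (h * g) ∂haar = ∫⁻ g, f g ∂haar := by
  rw [lintegral_haar (f := fun g => f (h * g))
    (hf.comp (ASL2.continuous_mul_left h).measurable), lintegral_haar hf,
    ← setLIntegral_detCone_comp (measurePreserving_matrixMulLeft h.lin)
      (det_matrixMulLeft h.lin) (measurable_lintegral_normalize hf)]
  refine setLIntegral_congr_fun isOpen_detCone.measurableSet fun A hA => ?_
  simp only [normalize_matrixMulLeft hA]
  rw [← lintegral_add_left_eq_self (fun ξ => f ⟨h.lin * normalize A, ξ⟩)
    (Matrix.vecMul h.shift (normalize A).1)]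
  rfl

theorem haar_univ_ne_zero : haar Set.univ ≠ 0 := by
  have h1 := lintegral_haar measurable_one
  simp only [Pi.one_apply, lintegral_one, lintegral_const] at h1
  rw [h1]
  have hne : detCone.Nonempty := by
    refine ⟨!![1 / 2, 0; 0, 1], ?_⟩
    change 0 < Matrix.det !![(1 / 2 : ℝ), 0; 0, 1] ∧ Matrix.det !![(1 / 2 : ℝ), 0; 0, 1] < 1
    rw [Matrix.det_fin_two_of]
    norm_num
  refine mul_ne_zero ?_ ?_
  · exact isOpen_univ.measure_ne_zero _ Set.univ_nonempty
  · rw [Measure.restrict_apply_univ]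
    exact isOpen_detCone.measure_ne_zero _ hne

end ASL2

end HaarMeasure

/-! ### A Siegel set of finite volume -/

section SiegelSet

open scoped MatrixGroups ENNReal

local notation "ℝ²" => (Fin 2 → ℝ)

local notation "ℝ⁴" => (Fin 2 → Fin 2 → ℝ)

namespace ASL2

/-- Matrices `M` for which `M • i` lies in the strip `|re| ≤ 1 / 2`, at height at least `1 / 2`. -/
def siegelSet : Set (SL(2, ℝ)) :=
  {M | 2 * |M.1 0 0 * M.1 1 0 + M.1 0 1 * M.1 1 1| ≤ M.1 1 0 ^ 2 + M.1 1 1 ^ 2 ∧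
    M.1 1 0 ^ 2 + M.1 1 1 ^ 2 ≤ 2}

theorem bottomRow_sq_pos (M : SL(2, ℝ)) : 0 < M.1 1 0 ^ 2 + M.1 1 1 ^ 2 := by
  have h := M.2
  rw [Matrix.det_fin_two] at h
  by_contra hn
  have h0 : M.1 1 0 = 0 := by nlinarith [sq_nonneg (M.1 1 0), sq_nonneg (M.1 1 1)]
  have h1 : M.1 1 1 = 0 := by nlinarith [sq_nonneg (M.1 1 0), sq_nonneg (M.1 1 1)]
  simp [h0, h1] at h

/-- The point `M • i` of the upper half plane, in terms of the rows of `M`. -/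
theorem coe_smul_I (M : SL(2, ℝ)) : ((M • UpperHalfPlane.I : UpperHalfPlane) : ℂ) =
    ⟨(M.1 0 0 * M.1 1 0 + M.1 0 1 * M.1 1 1) / (M.1 1 0 ^ 2 + M.1 1 1 ^ 2),
      1 / (M.1 1 0 ^ 2 + M.1 1 1 ^ 2)⟩ := by
  have hd := M.2
  rw [Matrix.det_fin_two] at hd
  have hn := (bottomRow_sq_pos M).ne'
  rw [UpperHalfPlane.coe_specialLinearGroup_apply, div_eq_iff]
  · apply Complex.ext
    · simp
      field_simp
      linear_combination -M.1 1 0 * hd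
    · simp
      field_simp
      linear_combination M.1 1 1 * hd
  · intro h
    have h0 := congrArg Complex.re h
    have h1 := congrArg Complex.im h
    simp at h0 h1
    simp [h0, h1] at hn

theorem map_smul_I (γ : SL(2, ℤ)) (M : SL(2, ℝ)) :
    (γ • (M • UpperHalfPlane.I) : UpperHalfPlane) =
      (γ.map (Int.castRingHom ℝ) * M) • UpperHalfPlane.I := by
  rw [mul_smul]
  rfl

/-- The Siegel set contains the preimage of the fundamental domain of `SL(2, ℤ)`, hence meets every
orbit. -/
theorem exists_map_mul_mem_siegelSet (M : SL(2, ℝ)) :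
    ∃ γ : SL(2, ℤ), γ.map (Int.castRingHom ℝ) * M ∈ siegelSet := by
  obtain ⟨γ, hγ⟩ := ModularGroup.exists_smul_mem_fd (M • UpperHalfPlane.I)
  refine ⟨γ, ?_⟩
  rw [map_smul_I] at hγ
  set N := γ.map (Int.castRingHom ℝ) * M with hN
  have hpos := bottomRow_sq_pos N
  have him := ModularGroup.three_le_four_mul_im_sq_of_mem_fd hγ
  have hre := hγ.2
  rw [← UpperHalfPlane.coe_im, coe_smul_I] at him
  rw [← UpperHalfPlane.coe_re, coe_smul_I] at hre
  simp only at him hre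
  constructor
  · rw [abs_div, abs_of_pos hpos, div_le_iff₀ hpos] at hre
    linarith
  · by_contra h2
    push Not at h2
    have : 1 / (N.1 1 0 ^ 2 + N.1 1 1 ^ 2) < 1 / 2 := one_div_lt_one_div_of_lt two_pos h2
    have h0 : 0 < 1 / (N.1 1 0 ^ 2 + N.1 1 1 ^ 2) := by positivity
    nlinarith

/-- The cone over the Siegel set has finite volume: for a given second row `w ≠ 0`, the first row
lies in a rectangle of area one. -/
theorem volume_cone_siegelSet_ne_top : volume {A | A ∈ detCone ∧ normalize A ∈ siegelSet} ≠ ∞ := by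
  set W : Set (ℝ² × ℝ²) := {p | (0 < p.1 0 * p.2 1 - p.1 1 * p.2 0 ∧
    p.1 0 * p.2 1 - p.1 1 * p.2 0 < 1) ∧
    2 * |p.1 0 * p.2 0 + p.1 1 * p.2 1| ≤ p.2 0 ^ 2 + p.2 1 ^ 2 ∧ p.2 0 ^ 2 + p.2 1 ^ 2 ≤ 2} with hW
  have hWm : MeasurableSet W := by
    have h1 : Measurable fun p : ℝ² × ℝ² => p.1 0 * p.2 1 - p.1 1 * p.2 0 := by fun_prop
    have h2 : Measurable fun p : ℝ² × ℝ² => p.2 0 ^ 2 + p.2 1 ^ 2 := by fun_prop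
    have h3 : Measurable fun p : ℝ² × ℝ² => 2 * |p.1 0 * p.2 0 + p.1 1 * p.2 1| :=
      Measurable.const_mul (Measurable.abs (by fun_prop)) _
    exact ((measurableSet_lt measurable_const h1).inter
      (measurableSet_lt h1 measurable_const)).inter
      ((measurableSet_le h3 h2).inter (measurableSet_le h2 measurable_const))
  have hsub : {A | A ∈ detCone ∧ normalize A ∈ siegelSet} ⊆
      (MeasurableEquiv.finTwoArrow : ℝ⁴ ≃ᵐ ℝ² × ℝ²) ⁻¹' W := by
    rintro A ⟨hA, h1, h2⟩
    have hd := hA.1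
    have hA' := hA
    simp only [detCone, Set.mem_ofPred_eq, Matrix.det_fin_two, Matrix.of_apply] at hA'
    simp only [normalize_apply hd] at h1 h2
    set δ := (Matrix.of A).det with hδ
    have hs : 0 < √δ := Real.sqrt_pos.2 hd
    have hs2 : √δ ^ 2 = δ := Real.sq_sqrt hd.le
    have hδ1 : δ < 1 := hA.2
    have e1 : (√δ)⁻¹ * A 0 0 * ((√δ)⁻¹ * A 1 0) + (√δ)⁻¹ * A 0 1 * ((√δ)⁻¹ * A 1 1) =
        (A 0 0 * A 1 0 + A 0 1 * A 1 1) / δ := by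
      conv_rhs => rw [← hs2]
      field_simp
    have e2 : ((√δ)⁻¹ * A 1 0) ^ 2 + ((√δ)⁻¹ * A 1 1) ^ 2 = (A 1 0 ^ 2 + A 1 1 ^ 2) / δ := by
      conv_rhs => rw [← hs2]
      field_simp
    rw [e1, e2, abs_div, abs_of_pos hd, ← mul_div_assoc, div_le_div_iff_of_pos_right hd] at h1
    rw [e2, div_le_iff₀ hd] at h2
    exact ⟨hA', h1, h2.trans (by linarith)⟩
  have hfiber (w : ℝ²) : volume ((fun u : ℝ² => (u, w)) ⁻¹' W) ≤
      {w : ℝ² | w 0 ^ 2 + w 1 ^ 2 ≤ 2}.indicator 1 w := by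
    by_cases hw2 : w 0 ^ 2 + w 1 ^ 2 ≤ 2
    swap
    · have : (fun u : ℝ² => (u, w)) ⁻¹' W = ∅ :=
        Set.eq_empty_of_forall_notMem fun u hu => hw2 hu.2.2
      rw [this, measure_empty]
      exact zero_le
    rw [Set.indicator_of_mem (by exact hw2), Pi.one_apply]
    by_cases hw : w = 0
    · have : (fun u : ℝ² => (u, w)) ⁻¹' W = ∅ :=
        Set.eq_empty_of_forall_notMem fun u hu => by
          have := hu.1.1
          simp [hw] at this
      rw [this, measure_empty]
      exact zero_le
    set n := w 0 ^ 2 + w 1 ^ 2 with hn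
    have hn0 : 0 < n := by
      by_contra h
      refine hw (funext fun i => ?_)
      fin_cases i
      · exact show w 0 = 0 by nlinarith [sq_nonneg (w 0), sq_nonneg (w 1)]
      · exact show w 1 = 0 by nlinarith [sq_nonneg (w 0), sq_nonneg (w 1)]
    -- The coordinates of `u` are the determinant and the inner product with `w`.
    have hB : Matrix.det !![w 1, -w 0; w 0, w 1] = n := by
      rw [Matrix.det_fin_two_of, hn]; ring
    have hBdet : LinearMap.det (Matrix.toLin' !![w 1, -w 0; w 0, w 1]) = n := by
      rw [LinearMap.det_toLin', hB]
    set s : Set ℝ² := Set.univ.pi ![Set.Ioo 0 1, Set.Icc (-(n / 2)) (n / 2)] with hs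
    have hsv : volume s = ENNReal.ofReal n := by
      rw [hs, volume_pi_pi, Fin.prod_univ_two]
      simp
    have hpre : (fun u : ℝ² => (u, w)) ⁻¹' W ⊆ Matrix.toLin' !![w 1, -w 0; w 0, w 1] ⁻¹' s := by
      rintro u ⟨h1, h2, -⟩
      have h3 := abs_le.1 (show |u 0 * w 0 + u 1 * w 1| ≤ n / 2 by linarith)
      simp only [hs, Set.mem_preimage, Set.mem_univ_pi, Matrix.toLin'_apply]
      intro i
      fin_cases i
      · simp only [Fin.zero_eta, Matrix.cons_val_zero, Set.mem_Ioo, Matrix.mulVec, dotProduct,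
          Fin.sum_univ_two, Matrix.of_apply, Matrix.cons_val_one]
        constructor <;> linarith [h1.1, h1.2]
      · simp only [Fin.mk_one, Matrix.cons_val_zero, Set.mem_Icc, Matrix.mulVec, dotProduct,
          Fin.sum_univ_two, Matrix.of_apply, Matrix.cons_val_one]
        constructor <;> linarith [h3.1, h3.2]
    refine (measure_mono hpre).trans ?_
    rw [Measure.addHaar_preimage_linearMap _ (by rw [hBdet]; exact hn0.ne'), hBdet, hsv,
      abs_of_pos (by positivity), ← ENNReal.ofReal_mul (by positivity), inv_mul_cancel₀ hn0.ne',
      ENNReal.ofReal_one]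
  refine ne_top_of_le_ne_top ?_ (measure_mono hsub)
  rw [(volume_preserving_finTwoArrow ℝ²).measure_preimage hWm.nullMeasurableSet,
    Measure.volume_eq_prod, Measure.prod_apply_symm hWm]
  have hdisc : {w : ℝ² | w 0 ^ 2 + w 1 ^ 2 ≤ 2} ⊆ Metric.closedBall 0 2 := by
    intro w hw
    have hw' : w 0 ^ 2 + w 1 ^ 2 ≤ 2 := hw
    rw [mem_closedBall_zero_iff, pi_norm_le_iff_of_nonneg two_pos.le]
    intro i
    rw [Real.norm_eq_abs]
    refine abs_le_of_sq_le_sq ?_ two_pos.le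
    fin_cases i
    · exact show w 0 ^ 2 ≤ 2 ^ 2 by nlinarith [sq_nonneg (w 1)]
    · exact show w 1 ^ 2 ≤ 2 ^ 2 by nlinarith [sq_nonneg (w 0)]
  have hdm : MeasurableSet {w : ℝ² | w 0 ^ 2 + w 1 ^ 2 ≤ 2} :=
    measurableSet_le (by fun_prop) measurable_const
  refine ne_top_of_le_ne_top ?_ (lintegral_mono hfiber)
  rw [lintegral_indicator_one hdm]
  exact ne_top_of_le_ne_top measure_closedBall_lt_top.ne (measure_mono hdisc)

end ASL2

end SiegelSet

/-! ### Existence of the invariant probability measure -/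

section Existence

open scoped MatrixGroups ENNReal

local notation "ℝ²" => (Fin 2 → ℝ)

namespace ASL2

instance : Countable (SL(2, ℤ)) :=
  Function.Injective.countable (f := fun (γ : SL(2, ℤ)) i j => γ.1 i j) fun _ _ h =>
    Subtype.ext h

/-- A function supported on the Siegel set, with finite sums over the orbits of `SL(2, ℤ)`: the
decay in both rows replaces the fact that a Siegel set meets an orbit in a finite set. -/
noncomputable def siegelDecay (M : SL(2, ℝ)) : ℝ≥0∞ :=
  siegelSet.indicator (fun M => decay (M.1 0) * decay (M.1 1)) M

/-- The sum of `siegelDecay` over an orbit of `SL(2, ℤ)`. -/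
noncomputable def orbitSum (M : SL(2, ℝ)) : ℝ≥0∞ :=
  ∑' γ : SL(2, ℤ), siegelDecay (γ.map (Int.castRingHom ℝ) * M)

theorem orbitSum_ne_zero (M : SL(2, ℝ)) : orbitSum M ≠ 0 := by
  obtain ⟨γ, hγ⟩ := exists_map_mul_mem_siegelSet M
  intro h
  have h1 := ENNReal.tsum_eq_zero.1 h γ
  rw [siegelDecay, Set.indicator_of_mem hγ] at h1
  exact mul_ne_zero (decay_ne_zero _) (decay_ne_zero _) h1

theorem map_mul_row (γ : SL(2, ℤ)) (M : SL(2, ℝ)) (i : Fin 2) :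
    (γ.map (Int.castRingHom ℝ) * M).1 i = Matrix.vecMul (intVec (γ.1 i)) M.1 := by
  ext j
  rw [Matrix.SpecialLinearGroup.coe_mul, Matrix.mul_apply]
  rfl

theorem orbitSum_ne_top (M : SL(2, ℝ)) : orbitSum M ≠ ∞ := by
  have hinj : Function.Injective fun γ : SL(2, ℤ) => (γ.1 0, γ.1 1) := fun γ γ' h => by
    have h0 := congrArg Prod.fst h
    have h1 := congrArg Prod.snd h
    refine Subtype.ext (funext fun i => ?_)
    fin_cases i
    · exact h0
    · exact h1
  refine ne_top_of_le_ne_top (ENNReal.mul_ne_top (latticeSum_ne_top M 0) (latticeSum_ne_top M 0)) ?_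
  calc orbitSum M ≤ ∑' γ : SL(2, ℤ), decay (Matrix.vecMul (intVec (γ.1 0)) M.1) *
        decay (Matrix.vecMul (intVec (γ.1 1)) M.1) := by
        refine ENNReal.tsum_le_tsum fun γ => ?_
        rw [← map_mul_row, ← map_mul_row]
        exact Set.indicator_le_self _ _ _
    _ ≤ ∑' p : (Fin 2 → ℤ) × (Fin 2 → ℤ), decay (Matrix.vecMul (intVec p.1) M.1) *
        decay (Matrix.vecMul (intVec p.2) M.1) :=
        ENNReal.tsum_comp_le_tsum_of_injective hinj fun p : (Fin 2 → ℤ) × (Fin 2 → ℤ) =>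
          decay (Matrix.vecMul (intVec p.1) M.1) * decay (Matrix.vecMul (intVec p.2) M.1)
    _ = latticeSum M 0 * latticeSum M 0 := by
        rw [ENNReal.tsum_prod']
        simp only [ENNReal.tsum_mul_left, ENNReal.tsum_mul_right, latticeSum, add_zero]

theorem orbitSum_map_mul (γ : SL(2, ℤ)) (M : SL(2, ℝ)) :
    orbitSum (γ.map (Int.castRingHom ℝ) * M) = orbitSum M := by
  refine (tsum_congr fun γ' => ?_).trans ((Equiv.mulRight γ).tsum_eq fun γ' : SL(2, ℤ) =>
    siegelDecay (γ'.map (Int.castRingHom ℝ) * M))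
  rw [← mul_assoc, Equiv.coe_mulRight, map_mul]

theorem measurable_row (i : Fin 2) : Measurable fun g : ASL2 => (g.lin.1 i : ℝ²) :=
  measurable_pi_lambda _ fun j => measurable_lin_apply i j

theorem measurable_siegelDecay : Measurable fun g : ASL2 => siegelDecay g.lin := by
  have h (i j : Fin 2) : Measurable fun g : ASL2 => g.lin.1 i j := measurable_lin_apply i j
  have h1 : MeasurableSet {g : ASL2 | g.lin ∈ siegelSet} := by
    have h2 : Measurable fun g : ASL2 => g.lin.1 1 0 ^ 2 + g.lin.1 1 1 ^ 2 :=
      ((h 1 0).pow_const 2).add ((h 1 1).pow_const 2)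
    have h3 : Measurable fun g : ASL2 =>
        2 * |g.lin.1 0 0 * g.lin.1 1 0 + g.lin.1 0 1 * g.lin.1 1 1| :=
      Measurable.const_mul (Measurable.abs (((h 0 0).mul (h 1 0)).add ((h 0 1).mul (h 1 1)))) _
    exact (measurableSet_le h3 h2).inter (measurableSet_le h2 measurable_const)
  have h4 : Measurable fun g : ASL2 => decay (g.lin.1 0) * decay (g.lin.1 1) :=
    (measurable_decay.comp (measurable_row 0)).mul (measurable_decay.comp (measurable_row 1))
  exact h4.indicator h1

theorem measurable_orbitSum : Measurable fun g : ASL2 => orbitSum g.lin :=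
  Measurable.tsum fun γ => measurable_siegelDecay.comp
    (ASL2.continuous_mul_left (ofInt γ 0)).measurable

/-- A function on `G'` whose sum over every `Γ'`-orbit is one. It replaces the indicator function
of a fundamental domain. -/
noncomputable def orbitWeight (g : ASL2) : ℝ≥0∞ :=
  siegelDecay g.lin / orbitSum g.lin * weight g.lin g.shift

theorem measurable_orbitWeight : Measurable orbitWeight := by
  have h := measurable_weight.comp (measurable_id.prodMk measurable_shift)
  exact (measurable_siegelDecay.div measurable_orbitSum).mul h

theorem tsum_orbitWeight_ofInt (g : ASL2) :
    ∑' γ : SL(2, ℤ), ∑' m : Fin 2 → ℤ, orbitWeight (ofInt γ m * g) = 1 := by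
  have h (γ : SL(2, ℤ)) : ∑' m : Fin 2 → ℤ, orbitWeight (ofInt γ m * g) =
      siegelDecay (γ.map (Int.castRingHom ℝ) * g.lin) / orbitSum g.lin := by
    simp only [orbitWeight, mul_lin, mul_shift, ofInt, orbitSum_map_mul, weight_map_mul]
    rw [ENNReal.tsum_mul_left, tsum_weight, mul_one]
  simp only [h, div_eq_mul_inv]
  rw [ENNReal.tsum_mul_right]
  exact ENNReal.mul_inv_cancel (orbitSum_ne_zero _) (orbitSum_ne_top _)

/-- The points of `Γ'` are parametrized by `SL(2, ℤ) × ℤ²`. -/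
noncomputable def integerPointsEquiv : SL(2, ℤ) × (Fin 2 → ℤ) ≃ integerPoints :=
  Equiv.ofBijective (fun p => ⟨ofInt p.1 p.2, ofInt_mem _ _⟩) <| by
    constructor
    · rintro ⟨γ, m⟩ ⟨γ', m'⟩ h
      have h1 := congrArg Subtype.val h
      have hlin := congrArg ASL2.lin h1
      have hshift := congrArg ASL2.shift h1
      refine Prod.ext (Matrix.SpecialLinearGroup.ext _ _ fun i j => ?_) (funext fun i => ?_)
      · have := congrArg (fun M : SL(2, ℝ) => M.1 i j) hlin
        simpa [ofInt] using this
      · have := congrFun hshift i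
        simpa [ofInt, intVec] using this
    · rintro ⟨_, γ, m, rfl⟩
      exact ⟨(γ, m), rfl⟩

instance : Countable integerPoints := integerPointsEquiv.symm.countable_iff.2 inferInstance

theorem tsum_orbitWeight (g : ASL2) : ∑' γ : integerPoints, orbitWeight (γ * g) = 1 := by
  rw [← integerPointsEquiv.tsum_eq, ENNReal.tsum_prod']
  exact tsum_orbitWeight_ofInt g

theorem orbitWeight_le (g : ASL2) :
    orbitWeight g ≤ ({g : ASL2 | g.lin ∈ siegelSet}.indicator 1 g) * weight g.lin g.shift := by
  refine mul_le_mul_left ?_ _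
  by_cases hg : g ∈ {g : ASL2 | g.lin ∈ siegelSet}
  · rw [Set.indicator_of_mem hg, Pi.one_apply]
    refine ENNReal.div_le_of_le_mul ?_
    rw [one_mul]
    refine le_trans (le_of_eq ?_) (ENNReal.le_tsum (1 : SL(2, ℤ)))
    rw [map_one, one_mul]
  · have : siegelDecay g.lin = 0 := Set.indicator_of_notMem (s := siegelSet) hg _
    rw [this, ENNReal.zero_div]
    exact zero_le

theorem lintegral_orbitWeight_ne_top : ∫⁻ g, orbitWeight g ∂haar ≠ ∞ := by
  rw [lintegral_haar measurable_orbitWeight]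
  refine ne_top_of_le_ne_top volume_cone_siegelSet_ne_top ?_
  set D : Set (Fin 2 → Fin 2 → ℝ) := {A | A ∈ detCone ∧ normalize A ∈ siegelSet} with hD
  calc ∫⁻ A in detCone, ∫⁻ ξ : ℝ², orbitWeight ⟨normalize A, ξ⟩
      ≤ ∫⁻ A in detCone, D.indicator 1 A := by
        refine setLIntegral_mono' isOpen_detCone.measurableSet fun A hA => ?_
        calc ∫⁻ ξ : ℝ², orbitWeight ⟨normalize A, ξ⟩
            ≤ ∫⁻ ξ : ℝ², D.indicator 1 A * weight (normalize A) ξ := by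
              refine lintegral_mono fun ξ => (orbitWeight_le _).trans (le_of_eq ?_)
              congr 1
              by_cases h : normalize A ∈ siegelSet
              · rw [Set.indicator_of_mem (by exact h), Set.indicator_of_mem (by exact ⟨hA, h⟩)]
                rfl
              · rw [Set.indicator_of_notMem (by exact h),
                  Set.indicator_of_notMem (fun h' => h h'.2)]
          _ = D.indicator 1 A := by
              rw [lintegral_const_mul _ (measurable_weight_right _), lintegral_weight, mul_one]
    _ ≤ ∫⁻ A, D.indicator 1 A := setLIntegral_le_lintegral _ _
    _ ≤ volume D := lintegral_indicator_one_le D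

theorem lintegral_orbitWeight_ne_zero : ∫⁻ g, orbitWeight g ∂haar ≠ 0 := by
  intro h
  refine haar_univ_ne_zero ?_
  calc haar Set.univ = ∫⁻ g, ∑' γ : integerPoints, orbitWeight (γ * g) ∂haar := by
        simp only [tsum_orbitWeight, lintegral_one]
    _ = ∑' γ : integerPoints, ∫⁻ g, orbitWeight (γ * g) ∂haar :=
        lintegral_tsum fun γ =>
          (measurable_orbitWeight.comp (ASL2.continuous_mul_left _).measurable).aemeasurable
    _ = 0 := by simp only [lintegral_haar_mul_left measurable_orbitWeight, h, tsum_zero]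

/-- The integral of a `Γ'`-invariant function against `orbitWeight`, that is, over the quotient, is
invariant under right translation. This is the usual unfolding argument. -/
theorem lintegral_mul_orbitWeight_mul_right {f : ASL2 → ℝ≥0∞} (hf : Measurable f)
    (hinv : IsLeftInvariant f) (h : ASL2) :
    ∫⁻ g, f (g * h) * orbitWeight g ∂haar = ∫⁻ g, f g * orbitWeight g ∂haar := by
  have hl (γ : ASL2) : Measurable fun g : ASL2 => γ * g := (ASL2.continuous_mul_left γ).measurable
  have hr (γ : ASL2) : Measurable fun g : ASL2 => g * γ := (ASL2.continuous_mul_right γ).measurable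
  have hw := measurable_orbitWeight
  have hwl (γ : ASL2) : Measurable fun g : ASL2 => orbitWeight (γ * g) := hw.comp (hl γ)
  have hwr : Measurable fun g : ASL2 => orbitWeight (g * h⁻¹) := hw.comp (hr _)
  calc ∫⁻ g, f (g * h) * orbitWeight g ∂haar
      = ∫⁻ g, f g * orbitWeight (g * h⁻¹) ∂haar := by
        rw [← lintegral_haar_mul_right (f := fun g => f g * orbitWeight (g * h⁻¹)) (hf.mul hwr) h]
        simp only [mul_inv_cancel_right]
    _ = ∫⁻ g, ∑' γ : integerPoints, f g * orbitWeight (g * h⁻¹) * orbitWeight (γ * g) ∂haar := by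
        simp only [ENNReal.tsum_mul_left, tsum_orbitWeight, mul_one]
    _ = ∑' γ : integerPoints, ∫⁻ g, f g * orbitWeight (g * h⁻¹) * orbitWeight (γ * g) ∂haar :=
        lintegral_tsum fun γ => ((hf.mul hwr).mul (hwl γ)).aemeasurable
    _ = ∑' γ : integerPoints, ∫⁻ g, f g * orbitWeight (γ⁻¹ * g * h⁻¹) * orbitWeight g ∂haar := by
        refine tsum_congr fun γ => ?_
        rw [← lintegral_haar_mul_left
          (f := fun g => f g * orbitWeight (g * h⁻¹) * orbitWeight (γ * g))
          ((hf.mul hwr).mul (hwl γ)) (γ⁻¹ : ASL2)]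
        refine lintegral_congr fun g => ?_
        simp only [InvMemClass.coe_inv, mul_inv_cancel_left, hinv.apply_mul (inv_mem γ.2)]
    _ = ∑' γ : integerPoints, ∫⁻ g, f g * orbitWeight (γ * g * h⁻¹) * orbitWeight g ∂haar :=
        (Equiv.inv integerPoints).tsum_eq fun γ : integerPoints =>
          ∫⁻ g, f g * orbitWeight (γ * g * h⁻¹) * orbitWeight g ∂haar
    _ = ∫⁻ g, ∑' γ : integerPoints, f g * orbitWeight (γ * g * h⁻¹) * orbitWeight g ∂haar :=
        (lintegral_tsum fun γ : integerPoints =>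
          ((hf.mul (hwr.comp (hl γ))).mul hw).aemeasurable).symm
    _ = ∫⁻ g, f g * orbitWeight g ∂haar := by
        refine lintegral_congr fun g => ?_
        simp only [ENNReal.tsum_mul_right, ENNReal.tsum_mul_left, mul_assoc]
        rw [tsum_orbitWeight, one_mul]

end ASL2

namespace AffineLatticeSpace

open ASL2

/-- The space of affine lattices has finite volume. -/
theorem exists_isHaarProbability : ∃ μ : Measure AffineLatticeSpace, IsHaarProbability μ := by
  set ν : Measure AffineLatticeSpace := (haar.withDensity orbitWeight).map mk with hν
  have hmk : Measurable AffineLatticeSpace.mk := measurable_mk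
  have hint {f : AffineLatticeSpace → ℝ≥0∞} (hf : Measurable f) :
      ∫⁻ x, f x ∂ν = ∫⁻ g, f (mk g) * orbitWeight g ∂haar := by
    rw [hν, lintegral_map hf hmk,
      lintegral_withDensity_eq_lintegral_mul _ measurable_orbitWeight
        (g := fun g => f (mk g)) (hf.comp hmk)]
    simp only [Pi.mul_apply, mul_comm]
  have huniv : ν Set.univ = ∫⁻ g, orbitWeight g ∂haar := by
    have h := hint measurable_one
    simpa using h
  have hmap (h : ASL2) : ν.map (translate h) = ν := by
    ext s hs
    have hm : Measurable (s.indicator (1 : AffineLatticeSpace → ℝ≥0∞)) :=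
      measurable_one.indicator hs
    rw [← lintegral_indicator_one hs, ← lintegral_indicator_one hs,
      lintegral_map hm (measurable_translate h), hint hm,
      hint (f := fun x => s.indicator 1 (translate h x)) (hm.comp (measurable_translate h))]
    refine lintegral_mul_orbitWeight_mul_right (f := fun g => s.indicator 1 (mk g)) (hm.comp hmk)
      (fun γ m g => ?_) h
    have : mk (ofInt γ m * g) = mk g := mk_eq_mk.2 (by
      rw [mul_inv_cancel_right]; exact ofInt_mem γ m)
    simp only [this]
  refine ⟨(ν Set.univ)⁻¹ • ν, ⟨?_⟩, fun g => ?_⟩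
  · rw [Measure.smul_apply, smul_eq_mul, huniv]
    exact ENNReal.inv_mul_cancel lintegral_orbitWeight_ne_zero lintegral_orbitWeight_ne_top
  · rw [Measure.map_smul, hmap]

end AffineLatticeSpace

end Existence

theorem mainTheorem7 {𝕜 : Type*} [RCLike 𝕜] :
    (∃ μ : Measure AffineLatticeSpace, AffineLatticeSpace.IsHaarProbability μ) ∧
    ∀ μ : Measure AffineLatticeSpace, AffineLatticeSpace.IsHaarProbability μ →
      ∀ F : (Fin 2 → ℝ) × (Fin 2 → ℝ) → 𝕜, Integrable F volume →
        (∀ᵐ x ∂μ, ∀ g : ASL2, AffineLatticeSpace.mk g = x →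
          Summable fun p : ASL2.DistinctPairs => ASL2.pairTerm F g p) ∧
        Integrable (AffineLatticeSpace.pairSum F) μ ∧
        ∫ x, AffineLatticeSpace.pairSum F x ∂μ = ∫ y, F y :=
  ⟨AffineLatticeSpace.exists_isHaarProbability, fun _ hμ _ hF => hμ.integral_pairSum hF⟩
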